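/- Let $d\ge 1$ be an integer, $\varrho>0$ a real number, $p\in[1,+\infty]$, and let $l\ge 0$, $s\in\{1,\ldots,l+1\}$ and $q,m\in\{0,\ldots,s\}$ be integers. For an open bounded connected set $U\subset\mathbb{R}^d$ of diameter $h_U$, let $W^{s,p}(U)$ be the space of functions whose weak derivatives of order up to $s$ exist and belong to $L^p(U)$, with seminorm $|v|_{W^{s,p}(U)}=\sum_{\alpha\in\mathbb{N}^d,\ \alpha_1+\cdots+\alpha_d=s}\|\partial^\alpha v\|_{L^p(U)}$, and let $\mathbb{P}^l(U)$ be the space of restrictions to $U$ of $d$-variate real polynomials of total degree at most $l$. For every real number $C_0>0$ there exists a real number $C>0$, depending only on $d,\varrho,l,q,m,s,p$ and $C_0$, such that the following holds. Let $U\subset\mathbb{R}^d$ be an open bounded connected set that is star-shaped with respect to every point of some ball of radius $\varrho h_U$, and let $\Pi:W^{q,1}(U)\to\mathbb{P}^l(U)$ be a projector, i.e. a linear map with $\Pi w=w$ for all $w\in\mathbb{P}^l(U)$, such that, for all $v\in W^{q,p}(U)$, $$\text{if } m<q:\quad |\Pi v|_{W^{m,p}(U)}\le C_0\sum_{r=m}^{q}h_U^{r-m}|v|_{W^{r,p}(U)},$$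 $$\text{if } m\ge q:\quad |\Pi v|_{W^{q,p}(U)}\le C_0|v|_{W^{q,p}(U)}.$$ Then, for all $v\in W^{s,p}(U)$, $$|v-\Pi v|_{W^{m,p}(U)}\le C\,h_U^{s-m}\,|v|_{W^{s,p}(U)}.$$ (In particular, if $C_0$ depends only on $d,\varrho,l,q,p$, then $C$ depends only on $d,\varrho,l,q,m,s,p$.) -/

import Mathlib

open MeasureTheory
open scoped ENNReal ContDiff

/-- The Euclidean space `ℝ^d`. -/
abbrev Space (d : ℕ) : Type := EuclideanSpace ℝ (Fin d)

/-- Classical partial derivative `∂_i f`. -/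
noncomputable def partialDeriv {d : ℕ} (i : Fin d) (f : Space d → ℝ) : Space d → ℝ :=
  fun x => fderiv ℝ f x (EuclideanSpace.single i 1)

/-- Classical iterated derivative `∂^α f = ∂_1^{α_1} ⋯ ∂_d^{α_d} f` for a multi-index `α`. -/
noncomputable def multiDeriv {d : ℕ} (α : Fin d → ℕ) (f : Space d → ℝ) : Space d → ℝ :=
  (List.finRange d).foldr (fun i g => (partialDeriv i)^[α i] g) f

/-- `φ ∈ C_c^∞(U)`. -/
structure IsTestFunction {d : ℕ} (U : Set (Space d)) (φ : Space d → ℝ) : Prop where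
  contDiff : ContDiff ℝ ∞ φ
  hasCompactSupport : HasCompactSupport φ
  tsupport_subset : tsupport φ ⊆ U

/-- `g` is the weak derivative `∂^α v` on `U`: both functions are locally integrable on `U` and
`∫_U v ∂^α φ = (-1)^{|α|} ∫_U g φ` for all `φ ∈ C_c^∞(U)`. -/
structure IsWeakDeriv {d : ℕ} (U : Set (Space d)) (α : Fin d → ℕ) (v g : Space d → ℝ) :
    Prop where
  locInt : LocallyIntegrableOn v U volume
  locInt_deriv : LocallyIntegrableOn g U volume
  integral_eq : ∀ φ : Space d → ℝ, IsTestFunction U φ →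
    ∫ x in U, v x * multiDeriv α φ x = (-1) ^ (∑ i, α i) * ∫ x in U, g x * φ x

/-- Functions on `U` up to almost everywhere equality. -/
abbrev AEFun {d : ℕ} (U : Set (Space d)) : Type := Space d →ₘ[volume.restrict U] ℝ

lemma IsTestFunction.partialDeriv {d : ℕ} {U : Set (Space d)} {φ : Space d → ℝ}
    (h : IsTestFunction U φ) (i : Fin d) : IsTestFunction U (partialDeriv i φ) where
  contDiff := (h.contDiff.fderiv_right (m := ∞) (by simp)).clm_apply contDiff_const
  hasCompactSupport := h.hasCompactSupport.fderiv_apply ℝ _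
  tsupport_subset := (tsupport_fderiv_apply_subset ℝ _).trans h.tsupport_subset

lemma IsTestFunction.multiDeriv {d : ℕ} {U : Set (Space d)} {φ : Space d → ℝ}
    (h : IsTestFunction U φ) (α : Fin d → ℕ) : IsTestFunction U (multiDeriv α φ) := by
  unfold _root_.multiDeriv
  induction List.finRange d with
  | nil => simpa using h
  | cons i L ih =>
    rw [List.foldr_cons]
    induction α i with
    | zero => simpa using ih
    | succ k ihk =>
      rw [Function.iterate_succ_apply']
      exact ihk.partialDeriv i

lemma IsTestFunction.integrable_mul {d : ℕ} {U : Set (Space d)} {φ v : Space d → ℝ}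
    (h : IsTestFunction U φ) (hv : LocallyIntegrableOn v U volume) :
    Integrable (fun x => v x * φ x) (volume.restrict U) := by
  have hK : IntegrableOn v (tsupport φ) volume :=
    hv.integrableOn_compact_subset h.tsupport_subset h.hasCompactSupport
  have h1 : IntegrableOn (fun x => v x * φ x) (tsupport φ) volume :=
    hK.mul_continuousOn h.contDiff.continuous.continuousOn h.hasCompactSupport
  have h2 : Integrable (fun x => v x * φ x) volume := by
    rw [← integrableOn_iff_integrable_of_support_subset (s := tsupport φ)]
    · exact h1
    · intro x hx
      exact subset_tsupport _ (right_ne_zero_of_mul hx)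
  exact h2.restrict

/-- Two weak derivatives of the same function agree almost everywhere on the open set `U`. -/
lemma IsWeakDeriv.ae_unique {d : ℕ} {U : Set (Space d)} (hU : IsOpen U) {α : Fin d → ℕ}
    {v g g' : Space d → ℝ} (h : IsWeakDeriv U α v g) (h' : IsWeakDeriv U α v g') :
    g =ᵐ[volume.restrict U] g' := by
  have key := hU.ae_eq_zero_of_integral_contDiff_smul_eq_zero
    (h.locInt_deriv.sub h'.locInt_deriv) (μ := volume) ?_
  · rw [Filter.EventuallyEq, ae_restrict_iff' hU.measurableSet]
    filter_upwards [key] with x hx hxU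
    exact sub_eq_zero.mp (hx hxU)
  · intro φ h1 h2 h3
    have hφ : IsTestFunction U φ := ⟨h1, h2, h3⟩
    have e := (h.integral_eq φ hφ).symm.trans (h'.integral_eq φ hφ)
    have e' := mul_left_cancel₀ (pow_ne_zero _ (by norm_num)) e
    rw [← setIntegral_eq_integral_of_forall_compl_eq_zero (s := U)]
    · have : ∀ x, φ x • (g - g') x = g x * φ x - g' x * φ x := by
        intro x; simp only [smul_eq_mul, Pi.sub_apply]; ring
      simp_rw [this]
      rw [integral_sub (hφ.integrable_mul h.locInt_deriv) (hφ.integrable_mul h'.locInt_deriv),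
        e', sub_self]
    · intro x hx
      rw [image_eq_zero_of_notMem_tsupport (fun hm => hx (h3 hm)), zero_smul]

lemma LocallyIntegrableOn.congr_restrict {d : ℕ} {U : Set (Space d)} {v w : Space d → ℝ}
    (h : v =ᵐ[volume.restrict U] w) (hv : LocallyIntegrableOn v U volume) :
    LocallyIntegrableOn w U volume := by
  intro x hx
  obtain ⟨s, hs, hvs⟩ := hv x hx
  refine ⟨s ∩ U, Filter.inter_mem hs self_mem_nhdsWithin, ?_⟩
  exact (hvs.mono_set Set.inter_subset_left).congr_fun_ae
    (ae_restrict_of_ae_restrict_of_subset Set.inter_subset_right h)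

lemma IsWeakDeriv.congr {d : ℕ} {U : Set (Space d)} {α : Fin d → ℕ} {v w g : Space d → ℝ}
    (h : v =ᵐ[volume.restrict U] w) (hv : IsWeakDeriv U α v g) : IsWeakDeriv U α w g where
  locInt := LocallyIntegrableOn.congr_restrict h hv.locInt
  locInt_deriv := hv.locInt_deriv
  integral_eq φ hφ := by
    rw [← hv.integral_eq φ hφ]
    exact integral_congr_ae (by filter_upwards [h] with x hx; rw [hx])

lemma IsWeakDeriv.add {d : ℕ} {U : Set (Space d)} {α : Fin d → ℕ} {v w g k : Space d → ℝ}
    (hv : IsWeakDeriv U α v g) (hw : IsWeakDeriv U α w k) :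
    IsWeakDeriv U α (v + w) (g + k) where
  locInt := hv.locInt.add hw.locInt
  locInt_deriv := hv.locInt_deriv.add hw.locInt_deriv
  integral_eq φ hφ := by
    simp only [Pi.add_apply, add_mul]
    rw [integral_add ((hφ.multiDeriv α).integrable_mul hv.locInt)
        ((hφ.multiDeriv α).integrable_mul hw.locInt),
      integral_add (hφ.integrable_mul hv.locInt_deriv) (hφ.integrable_mul hw.locInt_deriv),
      hv.integral_eq φ hφ, hw.integral_eq φ hφ, mul_add]

lemma IsWeakDeriv.smul {d : ℕ} {U : Set (Space d)} {α : Fin d → ℕ} {v g : Space d → ℝ}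
    (c : ℝ) (hv : IsWeakDeriv U α v g) : IsWeakDeriv U α (c • v) (c • g) where
  locInt := hv.locInt.smul c
  locInt_deriv := hv.locInt_deriv.smul c
  integral_eq φ hφ := by
    simp only [Pi.smul_apply, smul_eq_mul, mul_assoc]
    rw [integral_const_mul, integral_const_mul, hv.integral_eq φ hφ]
    ring

lemma IsWeakDeriv.zero {d : ℕ} (U : Set (Space d)) (α : Fin d → ℕ) :
    IsWeakDeriv U α 0 0 where
  locInt := locallyIntegrableOn_zero
  locInt_deriv := locallyIntegrableOn_zero
  integral_eq φ _ := by simp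

/-- The Sobolev space `W^{s,p}(U)`: (classes of) functions `v ∈ L^p(U)` all of whose weak
derivatives `∂^α v` with `|α| ≤ s` exist and belong to `L^p(U)`. -/
def Sobolev {d : ℕ} (U : Set (Space d)) (s : ℕ) (p : ℝ≥0∞) : Submodule ℝ (AEFun U) where
  carrier := {v | MemLp v p (volume.restrict U) ∧
    ∀ α : Fin d → ℕ, ∑ i, α i ≤ s →
      ∃ g : Space d → ℝ, MemLp g p (volume.restrict U) ∧ IsWeakDeriv U α v g}
  zero_mem' := by
    refine ⟨(MemLp.zero' (μ := volume.restrict U)).ae_eq AEEqFun.coeFn_zero.symm,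
      fun α _ => ⟨0, MemLp.zero', ?_⟩⟩
    exact (IsWeakDeriv.zero U α).congr AEEqFun.coeFn_zero.symm
  add_mem' := by
    rintro v w ⟨hv, hv'⟩ ⟨hw, hw'⟩
    refine ⟨(hv.add hw).ae_eq (AEEqFun.coeFn_add v w).symm, fun α hα => ?_⟩
    obtain ⟨g, hg, hvg⟩ := hv' α hα
    obtain ⟨k, hk, hwk⟩ := hw' α hα
    exact ⟨g + k, hg.add hk, (hvg.add hwk).congr (AEEqFun.coeFn_add v w).symm⟩
  smul_mem' := by
    rintro c v ⟨hv, hv'⟩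
    refine ⟨(hv.const_smul c).ae_eq (AEEqFun.coeFn_smul c v).symm, fun α hα => ?_⟩
    obtain ⟨g, hg, hvg⟩ := hv' α hα
    exact ⟨c • g, hg.const_smul c, (hvg.smul c).congr (AEEqFun.coeFn_smul c v).symm⟩

/-- On a bounded set, `W^{s,p}(U) ⊆ W^{q,r}(U)` for `q ≤ s` and `r ≤ p`. -/
lemma Sobolev.le_of_isBounded {d : ℕ} {U : Set (Space d)} (hU : Bornology.IsBounded U)
    {s q : ℕ} {p r : ℝ≥0∞} (hqs : q ≤ s) (hrp : r ≤ p) : Sobolev U s p ≤ Sobolev U q r := by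
  have : IsFiniteMeasure (volume.restrict U) := ⟨by simpa using hU.measure_lt_top⟩
  rintro v ⟨hv, hv'⟩
  refine ⟨hv.mono_exponent hrp, fun α hα => ?_⟩
  obtain ⟨g, hg, hvg⟩ := hv' α (hα.trans hqs)
  exact ⟨g, hg.mono_exponent hrp, hvg⟩

open Classical in
/-- The weak derivative `∂^α v` on `U` (unique almost everywhere on an open `U`; by convention `0`
if `v` has no such weak derivative). -/
noncomputable def weakDeriv {d : ℕ} (U : Set (Space d)) (α : Fin d → ℕ) (v : Space d → ℝ) :
    Space d → ℝ :=
  if h : ∃ g, IsWeakDeriv U α v g then h.choose else 0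

/-- The seminorm `|v|_{W^{s,p}(U)} = ∑_{|α| = s} ‖∂^α v‖_{L^p(U)}`. -/
noncomputable def sobolevSeminorm {d : ℕ} (U : Set (Space d)) (s : ℕ) (p : ℝ≥0∞)
    (v : Space d → ℝ) : ℝ≥0∞ :=
  ∑ α ∈ Finset.piAntidiag (Finset.univ : Finset (Fin d)) s,
    eLpNorm (weakDeriv U α v) p (volume.restrict U)

/-- The space `P^l(U)` of (classes of) restrictions to `U` of `d`-variate real polynomials of
total degree at most `l`. -/
def polySpace {d : ℕ} (U : Set (Space d)) (l : ℕ) : Submodule ℝ (AEFun U) where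
  carrier := {f | ∃ P : MvPolynomial (Fin d) ℝ, P.totalDegree ≤ l ∧
    f =ᵐ[volume.restrict U] fun x => MvPolynomial.eval (fun i => x i) P}
  zero_mem' := by
    refine ⟨0, by simp, ?_⟩
    filter_upwards [AEEqFun.coeFn_zero (μ := volume.restrict U) (β := ℝ)] with x hx
    rw [hx, map_zero, Pi.zero_apply]
  add_mem' := by
    rintro f g ⟨P, hP, hf⟩ ⟨Q, hQ, hg⟩
    refine ⟨P + Q, (MvPolynomial.totalDegree_add P Q).trans (max_le hP hQ), ?_⟩
    filter_upwards [hf, hg, AEEqFun.coeFn_add f g] with x h1 h2 h3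
    rw [h3, Pi.add_apply, h1, h2, map_add]
  smul_mem' := by
    rintro c f ⟨P, hP, hf⟩
    refine ⟨c • P, (MvPolynomial.totalDegree_smul_le c P).trans hP, ?_⟩
    filter_upwards [hf, AEEqFun.coeFn_smul c f] with x h1 h3
    rw [h3, Pi.smul_apply, h1, MvPolynomial.smul_eval, smul_eq_mul]

/-- `Pr : W^{q,1}(U) → P^l(U)` is a projector: a linear map that fixes every element of
`P^l(U)`. -/
def IsPolyProjector {d : ℕ} {U : Set (Space d)} {q l : ℕ}
    (Pr : Sobolev U q 1 →ₗ[ℝ] polySpace U l) : Prop :=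
  ∀ w : Sobolev U q 1, (w : AEFun U) ∈ polySpace U l → (Pr w : AEFun U) = w

/-! ### Multi-index calculus for classical derivatives -/

/-! Since `Pr` fixes polynomials of degree at most `l`, for every `Q` of degree at most `s - 1 ≤ l`
one has `v - Pr v = (v - Q) - Pr (v - Q)`. Write `h` for the diameter of `U`. The Bramble–Hilbert
lemma (`bramble_hilbert`) supplies one `Q` with `|v - Q|_r ≤ K h^(s-r) |v|_s` for all `r ≤ s` at
once. This bounds the first term. For `m < q` the stability hypothesis bounds the second, each
summand having the size `h^(r-m) h^(s-r) = h^(s-m)`. For `m ≥ q` stability is only known at order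
`q`, and the inverse inequality (`exists_inverse_inequality`) for the polynomial `Pr (v - Q)` passes
from order `q` to order `m` at the price `h^(q-m)`.

Bramble–Hilbert: let `B` be the ball of star-shapedness and choose `Q` so that all derivatives of `v
- Q` of order less than `s` have zero mean over `B`. The Poincaré inequality applied to each of them
gains one factor `h` per order, and at order `s` the polynomial has disappeared.

Poincaré: if `w` has zero mean over `B`, then `w x` is the average over `y ∈ B` of `w x - w y`,
which is at most `h` times the average of the gradient on the segment from `y` to `x`. At the point
`y + t (x - y)` one changes variables in `x` when `t ≥ 1/2` and in `y` when `t < 1/2`, so the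
Jacobian never costs more than `2^d`. The argument covers all `p` in `[1, ∞]` and uses no singular
kernel. Mollification justifies integrating a weak gradient along segments, and Fatou's lemma
removes it.

Inverse inequality: an affine change of variables places `U` between a ball of radius `ρ` and the
unit ball, where finite dimensionality of the polynomial space gives a constant independent of `U`.
-/

lemma ContDiff.partialDeriv {d : ℕ} {f : Space d → ℝ} (hf : ContDiff ℝ ∞ f) (i : Fin d) :
    ContDiff ℝ ∞ (partialDeriv i f) :=
  (hf.fderiv_right (m := ∞) (by simp)).clm_apply contDiff_const

lemma partialDeriv_comm {d : ℕ} {f : Space d → ℝ} (hf : ContDiff ℝ ∞ f) (i j : Fin d) :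
    partialDeriv i (partialDeriv j f) = partialDeriv j (partialDeriv i f) := by
  funext x
  have hd : DifferentiableAt ℝ (fderiv ℝ f) x :=
    (hf.fderiv_right (m := ∞) (by simp)).differentiable (by simp) x
  have key : ∀ a b : Fin d, partialDeriv a (partialDeriv b f) x =
      fderiv ℝ (fderiv ℝ f) x (EuclideanSpace.single a 1) (EuclideanSpace.single b 1) := by
    intro a b
    unfold partialDeriv
    rw [fderiv_clm_apply hd (differentiableAt_const _)]
    simp
  rw [key, key]
  exact (hf.contDiffAt.isSymmSndFDerivAt (by simp; exact WithTop.coe_le_coe.2 (le_top : (2 : ℕ∞) ≤ ⊤))) _ _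

lemma ContDiff.iterate_partialDeriv {d : ℕ} {f : Space d → ℝ} (hf : ContDiff ℝ ∞ f) (i : Fin d)
    (k : ℕ) : ContDiff ℝ ∞ ((_root_.partialDeriv i)^[k] f) := by
  induction k with
  | zero => simpa using hf
  | succ k ih => rw [Function.iterate_succ_apply']; exact ih.partialDeriv i

lemma iterate_partialDeriv_comm {d : ℕ} {f : Space d → ℝ} (hf : ContDiff ℝ ∞ f) (i j : Fin d)
    (k : ℕ) : (partialDeriv i)^[k] (partialDeriv j f) = partialDeriv j ((partialDeriv i)^[k] f) := by
  induction k with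
  | zero => rfl
  | succ k ih =>
    rw [Function.iterate_succ_apply', ih, Function.iterate_succ_apply',
      partialDeriv_comm (hf.iterate_partialDeriv i k)]

/-- The composition of the operators `∂_i^{α_i}` for `i` in the list `L`. -/
noncomputable def listDeriv {d : ℕ} (L : List (Fin d)) (α : Fin d → ℕ) (f : Space d → ℝ) :
    Space d → ℝ :=
  L.foldr (fun i g => (partialDeriv i)^[α i] g) f

lemma ContDiff.listDeriv {d : ℕ} {f : Space d → ℝ} (hf : ContDiff ℝ ∞ f) (L : List (Fin d))
    (α : Fin d → ℕ) : ContDiff ℝ ∞ (listDeriv L α f) := by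
  induction L with
  | nil => exact hf
  | cons i L ih => exact ih.iterate_partialDeriv i (α i)

lemma ContDiff.multiDeriv {d : ℕ} {f : Space d → ℝ} (hf : ContDiff ℝ ∞ f) (α : Fin d → ℕ) :
    ContDiff ℝ ∞ (multiDeriv α f) := hf.listDeriv _ _

lemma listDeriv_partialDeriv {d : ℕ} {f : Space d → ℝ} (hf : ContDiff ℝ ∞ f) (L : List (Fin d))
    (α : Fin d → ℕ) (i : Fin d) :
    listDeriv L α (partialDeriv i f) = partialDeriv i (listDeriv L α f) := by
  induction L with
  | nil => rfl
  | cons j L ih =>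
    change (partialDeriv j)^[α j] (listDeriv L α (partialDeriv i f)) = _
    rw [ih, iterate_partialDeriv_comm (hf.listDeriv L α)]
    rfl

lemma listDeriv_add_single_of_notMem {d : ℕ} (f : Space d → ℝ) (L : List (Fin d))
    (α : Fin d → ℕ) {i : Fin d} (hi : i ∉ L) :
    listDeriv L (α + Pi.single i 1) f = listDeriv L α f := by
  induction L with
  | nil => rfl
  | cons j L ih =>
    rw [List.mem_cons, not_or] at hi
    change (partialDeriv j)^[(α + Pi.single i 1 : Fin d → ℕ) j] (listDeriv L _ f) = _
    rw [ih hi.2, Pi.add_apply, Pi.single_eq_of_ne (Ne.symm hi.1), add_zero]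
    rfl

lemma listDeriv_add_single_of_mem {d : ℕ} {f : Space d → ℝ} (hf : ContDiff ℝ ∞ f)
    (L : List (Fin d)) (hL : L.Nodup) (α : Fin d → ℕ) {i : Fin d} (hi : i ∈ L) :
    listDeriv L (α + Pi.single i 1) f = partialDeriv i (listDeriv L α f) := by
  induction L with
  | nil => simp at hi
  | cons j L ih =>
    rw [List.nodup_cons] at hL
    change (partialDeriv j)^[(α + Pi.single i 1 : Fin d → ℕ) j] (listDeriv L _ f) =
      partialDeriv i ((partialDeriv j)^[α j] (listDeriv L α f))
    rcases eq_or_ne i j with rfl | hij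
    · rw [listDeriv_add_single_of_notMem f L α hL.1, Pi.add_apply, Pi.single_eq_same,
        Function.iterate_succ_apply']
    · rw [ih hL.2 ((List.mem_cons.mp hi).resolve_left hij), Pi.add_apply,
        Pi.single_eq_of_ne (Ne.symm hij), add_zero, iterate_partialDeriv_comm (hf.listDeriv L α)]

lemma multiDeriv_partialDeriv {d : ℕ} {f : Space d → ℝ} (hf : ContDiff ℝ ∞ f)
    (α : Fin d → ℕ) (i : Fin d) :
    multiDeriv α (partialDeriv i f) = partialDeriv i (multiDeriv α f) :=
  listDeriv_partialDeriv hf _ α i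

/-- The new `∂_i` has to be moved past the other factors of the ordered product, which uses the
symmetry of second derivatives. With `multiIndex_induction`, this lets every statement about
`multiDeriv` be proved one partial derivative at a time. -/
lemma multiDeriv_add_single {d : ℕ} {f : Space d → ℝ} (hf : ContDiff ℝ ∞ f)
    (α : Fin d → ℕ) (i : Fin d) :
    multiDeriv (α + Pi.single i 1) f = partialDeriv i (multiDeriv α f) :=
  listDeriv_add_single_of_mem hf _ (List.nodup_finRange d) α (List.mem_finRange i)

lemma multiDeriv_zero {d : ℕ} (f : Space d → ℝ) : multiDeriv 0 f = f := by
  unfold multiDeriv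
  induction List.finRange d with
  | nil => rfl
  | cons i L ih => rw [List.foldr_cons, ih]; rfl

lemma multiDeriv_single {d : ℕ} {f : Space d → ℝ} (hf : ContDiff ℝ ∞ f) (i : Fin d) :
    multiDeriv (Pi.single i 1) f = partialDeriv i f := by
  have := multiDeriv_add_single hf 0 i
  rwa [zero_add, multiDeriv_zero] at this

lemma sum_add_single {d : ℕ} (α : Fin d → ℕ) (i : Fin d) :
    ∑ j, (α + Pi.single i 1 : Fin d → ℕ) j = ∑ j, α j + 1 := by
  simp [Finset.sum_add_distrib]

lemma exists_eq_add_single {d : ℕ} {α : Fin d → ℕ} {i : Fin d} (h : α i ≠ 0) :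
    ∃ β : Fin d → ℕ, α = β + Pi.single i 1 := by
  refine ⟨α - Pi.single i 1, ?_⟩
  funext j
  rcases eq_or_ne j i with rfl | hj
  · simp; omega
  · simp [hj]

lemma multiIndex_induction {d : ℕ} {motive : (Fin d → ℕ) → Prop} (zero : motive 0)
    (step : ∀ α i, motive α → motive (α + Pi.single i 1)) (α : Fin d → ℕ) : motive α := by
  induction hn : ∑ i, α i generalizing α with
  | zero =>
    have : α = 0 := by
      funext i
      exact (Finset.sum_eq_zero_iff.mp hn) i (Finset.mem_univ i)
    rwa [this]
  | succ n ih =>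
    obtain ⟨i, -, hi⟩ := Finset.exists_ne_zero_of_sum_ne_zero (hn.trans_ne (Nat.succ_ne_zero n))
    obtain ⟨β, rfl⟩ := exists_eq_add_single hi
    rw [sum_add_single] at hn
    exact step β i (ih β (by omega))

/-! ### Weak derivatives -/

/-- The identity of order `α` is tested against `∂_i φ`. This makes the derivatives of order `r + 1`
the weak gradients of those of order `r`, the form in which the Poincaré inequality is applied. -/
lemma IsWeakDeriv.of_add_single {d : ℕ} {U : Set (Space d)} {α : Fin d → ℕ} {i : Fin d}
    {v g k : Space d → ℝ} (h : IsWeakDeriv U α v g) (h' : IsWeakDeriv U (α + Pi.single i 1) v k) :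
    IsWeakDeriv U (Pi.single i 1) g k where
  locInt := h.locInt_deriv
  locInt_deriv := h'.locInt_deriv
  integral_eq φ hφ := by
    have e1 := h.integral_eq _ (hφ.partialDeriv i)
    have e2 := h'.integral_eq φ hφ
    rw [multiDeriv_add_single hφ.contDiff, ← multiDeriv_partialDeriv hφ.contDiff, e1,
      sum_add_single, pow_succ, mul_assoc] at e2
    rw [multiDeriv_single hφ.contDiff, mul_left_cancel₀ (pow_ne_zero _ (by norm_num)) e2]
    simp

lemma IsWeakDeriv.add_single {d : ℕ} {U : Set (Space d)} {α : Fin d → ℕ} {i : Fin d}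
    {v g k : Space d → ℝ} (h : IsWeakDeriv U α v g) (h' : IsWeakDeriv U (Pi.single i 1) g k) :
    IsWeakDeriv U (α + Pi.single i 1) v k where
  locInt := h.locInt
  locInt_deriv := h'.locInt_deriv
  integral_eq φ hφ := by
    have e1 := h.integral_eq _ (hφ.partialDeriv i)
    have e2 := h'.integral_eq φ hφ
    rw [multiDeriv_single hφ.contDiff] at e2
    rw [multiDeriv_add_single hφ.contDiff, ← multiDeriv_partialDeriv hφ.contDiff, e1, e2,
      sum_add_single, pow_succ]
    simp

lemma IsWeakDeriv.congr_right {d : ℕ} {U : Set (Space d)} {α : Fin d → ℕ} {v g k : Space d → ℝ}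
    (h : g =ᵐ[volume.restrict U] k) (hv : IsWeakDeriv U α v g) : IsWeakDeriv U α v k where
  locInt := hv.locInt
  locInt_deriv := LocallyIntegrableOn.congr_restrict h hv.locInt_deriv
  integral_eq φ hφ := by
    rw [hv.integral_eq φ hφ]
    congr 1
    exact integral_congr_ae (by filter_upwards [h] with x hx; rw [hx])

lemma isWeakDeriv_zero_index {d : ℕ} {U : Set (Space d)} {v : Space d → ℝ}
    (hv : LocallyIntegrableOn v U volume) : IsWeakDeriv U 0 v v where
  locInt := hv
  locInt_deriv := hv
  integral_eq φ hφ := by simp [multiDeriv_zero]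

lemma setIntegral_mul_testFunction {d : ℕ} {U : Set (Space d)} {φ : Space d → ℝ}
    (hφ : IsTestFunction U φ) (f : Space d → ℝ) : ∫ x in U, f x * φ x = ∫ x, f x * φ x := by
  apply setIntegral_eq_integral_of_forall_compl_eq_zero
  intro x hx
  rw [image_eq_zero_of_notMem_tsupport (fun hm => hx (hφ.tsupport_subset hm)), mul_zero]

lemma isWeakDeriv_partialDeriv {d : ℕ} (U : Set (Space d)) {f : Space d → ℝ}
    (hf : ContDiff ℝ ∞ f) (i : Fin d) :
    IsWeakDeriv U (Pi.single i 1) f (partialDeriv i f) where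
  locInt := (hf.continuous.locallyIntegrable).locallyIntegrableOn U
  locInt_deriv := ((hf.partialDeriv i).continuous.locallyIntegrable).locallyIntegrableOn U
  integral_eq φ hφ := by
    rw [multiDeriv_single hφ.contDiff, setIntegral_mul_testFunction (hφ.partialDeriv i),
      setIntegral_mul_testFunction hφ]
    have hint : ∀ g ψ : Space d → ℝ, ContDiff ℝ ∞ g → IsTestFunction U ψ →
        Integrable (fun x => g x * ψ x) := fun g ψ hg hψ =>
      (hg.continuous.mul hψ.contDiff.continuous).integrable_of_hasCompactSupport
        hψ.hasCompactSupport.mul_left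
    have := integral_mul_fderiv_eq_neg_fderiv_mul_of_integrable (μ := volume) (f := f) (g := φ)
      (v := EuclideanSpace.single i 1) (hint _ _ (hf.partialDeriv i) hφ)
      (hint _ _ hf (hφ.partialDeriv i)) (hint _ _ hf hφ)
      (fun x _ => hf.differentiable (by simp) x) (fun x _ => hφ.contDiff.differentiable (by simp) x)
    simpa [partialDeriv] using this

lemma isWeakDeriv_multiDeriv {d : ℕ} (U : Set (Space d)) {f : Space d → ℝ}
    (hf : ContDiff ℝ ∞ f) (α : Fin d → ℕ) : IsWeakDeriv U α f (multiDeriv α f) := by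
  induction α using multiIndex_induction with
  | zero =>
    rw [multiDeriv_zero]
    exact isWeakDeriv_zero_index ((hf.continuous.locallyIntegrable).locallyIntegrableOn U)
  | step α i ih =>
    rw [multiDeriv_add_single hf]
    exact ih.add_single (isWeakDeriv_partialDeriv U (hf.multiDeriv α) i)

lemma IsWeakDeriv.weakDeriv_ae_eq {d : ℕ} {U : Set (Space d)} (hU : IsOpen U) {α : Fin d → ℕ}
    {v g : Space d → ℝ} (h : IsWeakDeriv U α v g) : weakDeriv U α v =ᵐ[volume.restrict U] g := by
  have hex : ∃ g, IsWeakDeriv U α v g := ⟨g, h⟩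
  rw [weakDeriv, dif_pos hex]
  exact hex.choose_spec.ae_unique hU h

lemma IsWeakDeriv.isWeakDeriv_weakDeriv {d : ℕ} {U : Set (Space d)} {α : Fin d → ℕ}
    {v g : Space d → ℝ} (h : IsWeakDeriv U α v g) : IsWeakDeriv U α v (weakDeriv U α v) := by
  have hex : ∃ g, IsWeakDeriv U α v g := ⟨g, h⟩
  rw [weakDeriv, dif_pos hex]
  exact hex.choose_spec

lemma IsWeakDeriv.sub {d : ℕ} {U : Set (Space d)} {α : Fin d → ℕ} {v w g k : Space d → ℝ}
    (hv : IsWeakDeriv U α v g) (hw : IsWeakDeriv U α w k) :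
    IsWeakDeriv U α (v - w) (g - k) := by
  have := hv.add (hw.smul (-1))
  simpa [sub_eq_add_neg] using this

/-! ### Averages and `L^p` norms of nonnegative functions -/

lemma lintegral_le_eLpNorm {Y : Type*} [MeasurableSpace Y] {ν : Measure Y} [IsProbabilityMeasure ν]
    {p : ℝ≥0∞} (hp : 1 ≤ p) {f : Y → ℝ≥0∞} (hf : Measurable f) : ∫⁻ y, f y ∂ν ≤ eLpNorm f p ν := by
  have := eLpNorm_le_eLpNorm_of_exponent_le (μ := ν) hp hf.aestronglyMeasurable
  rwa [eLpNorm_one_eq_lintegral_enorm] at this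

lemma eLpNorm_le_iff_lintegral_rpow {X : Type*} [MeasurableSpace X] {μ : Measure X} {p : ℝ≥0∞}
    (hp : 1 ≤ p) (hp' : p ≠ ⊤) {f : X → ℝ≥0∞} {A : ℝ≥0∞} :
    eLpNorm f p μ ≤ A ↔ ∫⁻ x, f x ^ p.toReal ∂μ ≤ A ^ p.toReal := by
  have h0 : p ≠ 0 := (zero_lt_one.trans_le hp).ne'
  rw [eLpNorm_eq_lintegral_rpow_enorm_toReal h0 hp', one_div,
    ENNReal.rpow_inv_le_iff (ENNReal.toReal_pos h0 hp')]
  simp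

/-- Minkowski's inequality for an average of functions with a common `L^p` bound. -/
lemma eLpNorm_lintegral_le {X Y : Type*} [MeasurableSpace X] [MeasurableSpace Y] {μ : Measure X}
    [SFinite μ] {ν : Measure Y} [IsProbabilityMeasure ν] {p : ℝ≥0∞} (hp : 1 ≤ p)
    {F : X → Y → ℝ≥0∞} (hF : Measurable (Function.uncurry F)) {A : ℝ≥0∞}
    (hA : ∀ᵐ y ∂ν, eLpNorm (fun x => F x y) p μ ≤ A) :
    eLpNorm (fun x => ∫⁻ y, F x y ∂ν) p μ ≤ A := by
  rcases eq_or_ne p ⊤ with rfl | hp'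
  · rw [eLpNorm_exponent_top]
    have h1 : ∀ᵐ y ∂ν, ∀ᵐ x ∂μ, F x y ≤ A := by
      filter_upwards [hA] with y hy
      filter_upwards [enorm_ae_le_eLpNormEssSup (fun x => F x y) μ] with x hx
      rw [eLpNorm_exponent_top] at hy
      exact hx.trans hy
    rw [← Measure.ae_ae_comm (p := fun x y => F x y ≤ A) (measurableSet_le hF measurable_const)] at h1
    refine eLpNormEssSup_le_of_ae_enorm_bound ?_
    filter_upwards [h1] with x hx
    calc ∫⁻ y, F x y ∂ν ≤ ∫⁻ _, A ∂ν := lintegral_mono_ae hx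
      _ = A := by simp
  · rw [eLpNorm_le_iff_lintegral_rpow hp hp']
    -- For finite `p`, Jensen's inequality for the probability measure `ν` followed by Tonelli.
    have hjensen : ∀ x, (∫⁻ y, F x y ∂ν) ^ p.toReal ≤ ∫⁻ y, F x y ^ p.toReal ∂ν := by
      intro x
      have h0 : p ≠ 0 := (zero_lt_one.trans_le hp).ne'
      have := lintegral_le_eLpNorm (ν := ν) hp (hF.comp (measurable_prodMk_left (x := x)))
      rw [eLpNorm_eq_lintegral_rpow_enorm_toReal h0 hp', one_div,
        ENNReal.le_rpow_inv_iff (ENNReal.toReal_pos h0 hp')] at this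
      simpa using this
    calc ∫⁻ x, (∫⁻ y, F x y ∂ν) ^ p.toReal ∂μ
        ≤ ∫⁻ x, ∫⁻ y, F x y ^ p.toReal ∂ν ∂μ := lintegral_mono hjensen
      _ = ∫⁻ y, ∫⁻ x, F x y ^ p.toReal ∂μ ∂ν :=
          lintegral_lintegral_swap (hF.pow_const _).aemeasurable
      _ ≤ ∫⁻ _, A ^ p.toReal ∂ν := by
          apply lintegral_mono_ae
          filter_upwards [hA] with y hy
          exact (eLpNorm_le_iff_lintegral_rpow hp hp').1 hy
      _ = A ^ p.toReal := by simp

/-- Fatou's lemma; it transfers bounds uniform in the mollification parameter to the limit. -/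
lemma eLpNorm_liminf_le {X : Type*} [MeasurableSpace X] {μ : Measure X} {p : ℝ≥0∞} (hp : 1 ≤ p)
    {f : ℕ → X → ℝ≥0∞} (hf : ∀ n, Measurable (f n)) {A : ℝ≥0∞}
    (hA : ∀ n, eLpNorm (f n) p μ ≤ A) :
    eLpNorm (fun x => Filter.liminf (fun n => f n x) Filter.atTop) p μ ≤ A := by
  rcases eq_or_ne p ⊤ with rfl | hp'
  · rw [eLpNorm_exponent_top]
    have h1 : ∀ n, ∀ᵐ x ∂μ, f n x ≤ A := by
      intro n
      have hn := hA n
      rw [eLpNorm_exponent_top] at hn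
      filter_upwards [enorm_ae_le_eLpNormEssSup (f n) μ] with x hx
      exact hx.trans hn
    refine eLpNormEssSup_le_of_ae_enorm_bound ?_
    filter_upwards [ae_all_iff.2 h1] with x hx
    refine (Filter.liminf_le_liminf (v := fun _ : ℕ => A) (Filter.Eventually.of_forall hx)).trans ?_
    simp
  · rw [eLpNorm_le_iff_lintegral_rpow hp hp']
    have h0 : p ≠ 0 := (zero_lt_one.trans_le hp).ne'
    have hpos := ENNReal.toReal_pos h0 hp'
    have hlim : ∀ x, (Filter.liminf (fun n => f n x) Filter.atTop) ^ p.toReal =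
        Filter.liminf (fun n => f n x ^ p.toReal) Filter.atTop := by
      intro x
      exact (ENNReal.orderIsoRpow p.toReal hpos).liminf_apply
    simp_rw [hlim]
    refine (lintegral_liminf_le fun n => (hf n).pow_const _).trans ?_
    refine (Filter.liminf_le_liminf (v := fun _ : ℕ => A ^ p.toReal) (Filter.Eventually.of_forall
      fun n => (eLpNorm_le_iff_lintegral_rpow hp hp').1 (hA n))).trans ?_
    simp

/-- The dilation contributes `(t⁻¹)^d ≤ 2^d` to the power `1/p ≤ 1`. Bounding this by `2^d` gives a
constant free of `p`, and includes `p = ∞`, where the exponent is `0`. -/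
lemma eLpNorm_comp_add_smul_le {d : ℕ} {p : ℝ≥0∞} (hp : 1 ≤ p) {K : Space d → ℝ≥0∞}
    (hK : Measurable K) (a : Space d) {t : ℝ} (ht : 1 / 2 ≤ t) :
    eLpNorm (fun x => K (a + t • x)) p volume ≤ 2 ^ d * eLpNorm K p volume := by
  have ht0 : 0 < t := by linarith
  have h1 : eLpNorm (fun x => K (a + x)) p volume = eLpNorm K p volume :=
    eLpNorm_comp_measurePreserving hK.aestronglyMeasurable (measurePreserving_add_left volume a)
  have hK' : Measurable fun x => K (a + x) := hK.comp (measurable_const_add a)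
  have h2 := eLpNorm_map_measure (μ := volume) (p := p) (f := fun x : Space d => t • x)
    (g := fun x => K (a + x)) hK'.aestronglyMeasurable (measurable_const_smul t).aemeasurable
  change _ = eLpNorm (fun x => K (a + t • x)) p volume at h2
  rw [← h2, Measure.map_addHaar_smul volume ht0.ne', finrank_euclideanSpace, Fintype.card_fin,
    ← h1]
  refine (eLpNorm_smul_measure_le _ _ _ _).trans ?_
  rw [smul_eq_mul]
  gcongr
  have hb : ENNReal.ofReal |(t ^ d)⁻¹| ≤ 2 ^ d := by
    rw [abs_of_pos (by positivity), ← inv_pow]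
    have : t⁻¹ ≤ 2 := by
      rw [inv_le_comm₀ ht0 (by norm_num)]; linarith
    calc ENNReal.ofReal (t⁻¹ ^ d) ≤ ENNReal.ofReal (2 ^ d) := by gcongr
      _ = 2 ^ d := by rw [ENNReal.ofReal_pow (by norm_num)]; simp
  have he0 : 0 ≤ (1 / p).toReal := ENNReal.toReal_nonneg
  have he1 : (1 / p).toReal ≤ 1 := by
    have : 1 / p ≤ 1 := by rw [one_div]; exact ENNReal.inv_le_one.2 hp
    simpa using ENNReal.toReal_mono ENNReal.one_ne_top this
  calc ENNReal.ofReal |(t ^ d)⁻¹| ^ (1 / p).toReal ≤ (2 ^ d : ℝ≥0∞) ^ (1 / p).toReal := by gcongr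
    _ ≤ (2 ^ d : ℝ≥0∞) ^ (1 : ℝ) :=
        ENNReal.rpow_le_rpow_of_exponent_le (one_le_pow₀ (by norm_num)) he1
    _ = 2 ^ d := by simp

/-- The average over `y ∈ B` and over the segment from `y` to `x` of a nonnegative function is
bounded in `L^p(U)` when `|U| ≤ A |B|`. -/
lemma eLpNorm_average_segment_le {d : ℕ} {p : ℝ≥0∞} (hp : 1 ≤ p) {K : Space d → ℝ≥0∞}
    (hK : Measurable K) {U B : Set (Space d)} (hB0 : volume B ≠ 0)
    (hBt : volume B ≠ ⊤) {A : ℝ≥0∞} (hA : 1 ≤ A) (hUB : volume U ≤ A * volume B) :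
    eLpNorm (fun x => ∫⁻ y, (∫⁻ t in Set.Ioc (0 : ℝ) 1, K (y + t • (x - y)))
        ∂(ProbabilityTheory.cond volume B)) p (volume.restrict U) ≤
      2 ^ (d + 1) * A * eLpNorm K p volume := by
  have : IsProbabilityMeasure (ProbabilityTheory.cond volume B) :=
    ProbabilityTheory.cond_isProbabilityMeasure_of_finite hB0 hBt
  set ν := ProbabilityTheory.cond volume B with hν
  set τ : Measure ℝ := volume.restrict (Set.Ioc (0 : ℝ) 1) with hτ
  have : IsProbabilityMeasure τ := ⟨by simp [hτ]⟩
  -- For `t ∈ S` the map `x ↦ y + t (x - y)` contracts by a factor at least `1/2`; for `t ∉ S` the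
  -- same holds for `y ↦ y + t (x - y)`, whose factor is `1 - t`.
  set S : Set ℝ := Set.Ici (1 / 2) with hS
  have hSm : MeasurableSet S := measurableSet_Ici
  have hKm : Measurable fun z : Space d × Space d × ℝ => K (z.2.1 + z.2.2 • (z.1 - z.2.1)) :=
    hK.comp (by fun_prop)
  have hi : ∀ T : Set ℝ, MeasurableSet T → Measurable fun z : Space d × Space d × ℝ =>
      T.indicator (fun t => K (z.2.1 + t • (z.1 - z.2.1))) z.2.2 := by
    intro T hT
    have : (fun z : Space d × Space d × ℝ =>
        T.indicator (fun t => K (z.2.1 + t • (z.1 - z.2.1))) z.2.2) =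
        Set.indicator {z | z.2.2 ∈ T} fun z => K (z.2.1 + z.2.2 • (z.1 - z.2.1)) := by
      ext z; simp [Set.indicator]
    rw [this]
    exact hKm.indicator (measurable_snd.snd hT)
  have hsplit : ∀ x, ∫⁻ y, ∫⁻ t, K (y + t • (x - y)) ∂τ ∂ν =
      ∫⁻ z : Space d × ℝ, S.indicator (fun t => K (z.1 + t • (x - z.1))) z.2 ∂(ν.prod τ) +
      ∫⁻ z : ℝ × Space d, Sᶜ.indicator (fun t => K (z.2 + t • (x - z.2))) z.1 ∂(τ.prod ν) := by
    intro x
    rw [← lintegral_prod_swap (μ := τ) (ν := ν)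
      (fun z : ℝ × Space d => Sᶜ.indicator (fun t => K (z.2 + t • (x - z.2))) z.1)]
    simp only [Prod.fst_swap, Prod.snd_swap]
    have hm1 : Measurable fun z : Space d × ℝ => S.indicator (fun t => K (z.1 + t • (x - z.1))) z.2 :=
      (hi S hSm).comp measurable_prodMk_left
    rw [← lintegral_add_left hm1,
      ← lintegral_prod (fun z : Space d × ℝ => K (z.1 + z.2 • (x - z.1)))
        (hKm.comp (measurable_prodMk_left (x := x))).aemeasurable]
    congr 1
    funext z
    by_cases h : z.2 ∈ S <;> simp [h]
  simp_rw [hsplit]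
  have hfar : eLpNorm (fun x => ∫⁻ z : Space d × ℝ,
      S.indicator (fun t => K (z.1 + t • (x - z.1))) z.2 ∂(ν.prod τ)) p (volume.restrict U) ≤
      2 ^ d * eLpNorm K p volume := by
    apply eLpNorm_lintegral_le hp (hi S hSm)
    refine Filter.Eventually.of_forall fun ⟨y, t⟩ => ?_
    by_cases h : t ∈ S
    · simp only [Set.indicator_of_mem h]
      refine (eLpNorm_mono_measure _ Measure.restrict_le_self).trans ?_
      have := eLpNorm_comp_add_smul_le hp hK (y - t • y) (t := t) h
      refine le_of_eq_of_le ?_ this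
      congr 1; funext x; congr 1; rw [smul_sub]; abel
    · simp [h]
  have hnear : eLpNorm (fun x => ∫⁻ z : ℝ × Space d,
      Sᶜ.indicator (fun t => K (z.2 + t • (x - z.2))) z.1 ∂(τ.prod ν)) p (volume.restrict U) ≤
      2 ^ d * A * eLpNorm K p volume := by
    set e := (1 / p).toReal with he
    have he0 : 0 ≤ e := ENNReal.toReal_nonneg
    have he1 : e ≤ 1 := by
      have : 1 / p ≤ 1 := by rw [one_div]; exact ENNReal.inv_le_one.2 hp
      simpa [he] using ENNReal.toReal_mono ENNReal.one_ne_top this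
    -- Here the variable of integration is `y`, so the bound is pointwise in `x`. Normalizing the
    -- measure on `B` costs `|B|^(-1/p)`; taking the norm over `U` then costs `|U|^(1/p)`, and the
    -- two combine into a factor at most `A`.
    have hpt : ∀ x, ∫⁻ z : ℝ × Space d,
        Sᶜ.indicator (fun t => K (z.2 + t • (x - z.2))) z.1 ∂(τ.prod ν) ≤
        (volume B)⁻¹ ^ e * (2 ^ d * eLpNorm K p volume) := by
      intro x
      have hm2 : Measurable fun z : ℝ × Space d =>
          Sᶜ.indicator (fun t => K (z.2 + t • (x - z.2))) z.1 :=
        (hi Sᶜ hSm.compl).comp (measurable_prodMk_left.comp measurable_swap)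
      rw [lintegral_prod _ hm2.aemeasurable]
      refine (lintegral_mono (g := fun _ => (volume B)⁻¹ ^ e * (2 ^ d * eLpNorm K p volume))
        fun t => ?_).trans (by simp)
      by_cases h : t ∈ S
      · simp [h]
      · simp only [Set.indicator_of_mem (Set.mem_compl h)]
        have ht : 1 / 2 ≤ 1 - t := by
          have : t < 1 / 2 := not_le.1 h
          linarith
        have hcomp : (fun y => K (y + t • (x - y))) = fun y => K (t • x + (1 - t) • y) := by
          funext y; congr 1; rw [smul_sub, sub_smul, one_smul]; abel
        rw [hcomp]
        refine (lintegral_le_eLpNorm hp (hK.comp (by fun_prop))).trans ?_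
        rw [hν, ProbabilityTheory.cond]
        refine (eLpNorm_smul_measure_le _ _ _ _).trans ?_
        rw [smul_eq_mul]
        gcongr
        exact (eLpNorm_mono_measure _ Measure.restrict_le_self).trans
          (eLpNorm_comp_add_smul_le hp hK (t • x) ht)
    refine (eLpNorm_le_of_ae_enorm_bound (C := (volume B)⁻¹ ^ e * (2 ^ d * eLpNorm K p volume))
      (Filter.Eventually.of_forall hpt)).trans ?_
    have hpe : p.toReal⁻¹ = e := by simp [he]
    rw [Measure.restrict_apply_univ, hpe, smul_eq_mul]
    have hratio : (volume B)⁻¹ ^ e * volume U ^ e ≤ A := by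
      rw [← ENNReal.mul_rpow_of_nonneg _ _ he0]
      calc ((volume B)⁻¹ * volume U) ^ e ≤ A ^ e := by
            gcongr
            calc (volume B)⁻¹ * volume U ≤ (volume B)⁻¹ * (A * volume B) := by gcongr
              _ = A * ((volume B)⁻¹ * volume B) := by ring
              _ = A := by rw [ENNReal.inv_mul_cancel hB0 hBt, mul_one]
        _ ≤ A ^ (1 : ℝ) := ENNReal.rpow_le_rpow_of_exponent_le hA he1
        _ = A := by simp
    calc (volume B)⁻¹ ^ e * (2 ^ d * eLpNorm K p volume) * volume U ^ e
        = 2 ^ d * ((volume B)⁻¹ ^ e * volume U ^ e) * eLpNorm K p volume := by ring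
      _ ≤ _ := by gcongr
  refine (eLpNorm_add_le ?_ ?_ hp).trans ((add_le_add hfar hnear).trans ?_)
  · exact (Measurable.lintegral_prod_right' (hi S hSm)).aestronglyMeasurable
  · refine (Measurable.lintegral_prod_right' (f := fun z : Space d × ℝ × Space d =>
      Sᶜ.indicator (fun t => K (z.2.2 + t • (z.1 - z.2.2))) z.2.1) ?_).aestronglyMeasurable
    exact (hi Sᶜ hSm.compl).comp (by fun_prop :
      Measurable fun z : Space d × ℝ × Space d => (z.1, z.2.2, z.2.1))
  · calc 2 ^ d * eLpNorm K p volume + 2 ^ d * A * eLpNorm K p volume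
        ≤ 2 ^ d * A * eLpNorm K p volume + 2 ^ d * A * eLpNorm K p volume := by
          gcongr
          exact le_mul_of_one_le_right (by positivity) hA
      _ = 2 ^ (d + 1) * A * eLpNorm K p volume := by ring

/-! ### Mollification -/

open scoped Convolution in
/-- The mollification of `w 1_U` by the normalized bump function `φ`. -/
noncomputable def mollify {d : ℕ} (φ : ContDiffBump (0 : Space d)) (U : Set (Space d))
    (w : Space d → ℝ) : Space d → ℝ :=
  φ.normed volume ⋆[ContinuousLinearMap.lsmul ℝ ℝ, volume] U.indicator w

section Mollify

variable {d : ℕ} (φ : ContDiffBump (0 : Space d)) {U : Set (Space d)} {w : Space d → ℝ}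

lemma contDiff_mollify (hw : Integrable (U.indicator w)) : ContDiff ℝ 1 (mollify φ U w) :=
  φ.hasCompactSupport_normed.contDiff_convolution_left (n := 1) _ φ.contDiff_normed
    hw.locallyIntegrable

lemma isTestFunction_normed_sub {x : Space d} (hx : Metric.closedBall x φ.rOut ⊆ U) :
    IsTestFunction U fun u => φ.normed volume (x - u) where
  contDiff := (φ.contDiff_normed (n := ⊤)).comp (contDiff_const.sub contDiff_id)
  hasCompactSupport :=
    (φ.hasCompactSupport_normed (μ := volume)).comp_homeomorph (Homeomorph.subLeft x)
  tsupport_subset := by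
    refine (closure_minimal (fun u hu => ?_) Metric.isClosed_closedBall).trans hx
    have : x - u ∈ Function.support (φ.normed volume) := hu
    rw [φ.support_normed_eq (μ := volume), mem_ball_zero_iff] at this
    rw [Metric.mem_closedBall, dist_comm, dist_eq_norm]
    exact this.le

lemma fderiv_mollify_single (hw : Integrable (U.indicator w)) (x : Space d) (i : Fin d) :
    fderiv ℝ (mollify φ U w) x (EuclideanSpace.single i 1) =
      -∫ u, U.indicator w u * partialDeriv i (fun u => φ.normed volume (x - u)) u := by
  have h := (φ.hasCompactSupport_normed (μ := volume)).hasFDerivAt_convolution_left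
    (ContinuousLinearMap.lsmul ℝ ℝ) (μ := volume) (φ.contDiff_normed (n := 1))
    hw.locallyIntegrable x
  rw [mollify, h.fderiv, convolution_eq_swap, ContinuousLinearMap.integral_apply, ← integral_neg]
  · congr 1
    funext u
    have hd : DifferentiableAt ℝ (φ.normed volume) (x - u) :=
      (φ.contDiff_normed (n := 1)).differentiable (by simp) _
    have := (hd.hasFDerivAt.comp u ((hasFDerivAt_id u).const_sub x)).fderiv
    change fderiv ℝ (fun u => φ.normed volume (x - u)) u = _ at this
    rw [partialDeriv, this]
    simp [ContinuousLinearMap.precompL_apply, mul_comm]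
  · have := ((φ.hasCompactSupport_normed (μ := volume)).fderiv ℝ).convolutionExists_left
      ((ContinuousLinearMap.lsmul ℝ ℝ).precompL (Space d))
      ((φ.contDiff_normed (μ := volume) (n := 1)).continuous_fderiv (by simp))
      hw.locallyIntegrable x
    exact this.integrable_swap

/-- Because the bump centred at `x` is supported in `U`, it is an admissible test function and the
derivative moves onto `w`. The sign of the weak derivative cancels that of `fderiv_mollify_single`.
-/
lemma enorm_fderiv_mollify_single_le (hU : MeasurableSet U) (hw : Integrable (U.indicator w))
    {x : Space d} (hx : Metric.closedBall x φ.rOut ⊆ U) {i : Fin d} {g : Space d → ℝ}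
    (hg : IsWeakDeriv U (Pi.single i 1) w g) :
    ‖fderiv ℝ (mollify φ U w) x (EuclideanSpace.single i 1)‖ₑ ≤
      ∫⁻ u in U, ‖g u‖ₑ * ENNReal.ofReal (φ.normed volume (x - u)) := by
  have hφ := isTestFunction_normed_sub φ hx
  have e := hg.integral_eq _ hφ
  rw [multiDeriv_single hφ.contDiff] at e
  have e' : ∫ u, U.indicator w u * partialDeriv i (fun u => φ.normed volume (x - u)) u =
      ∫ u in U, w u * partialDeriv i (fun u => φ.normed volume (x - u)) u := by
    rw [← integral_indicator hU]
    congr 1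
    funext u
    by_cases h : u ∈ U <;> simp [h]
  rw [fderiv_mollify_single φ hw, e', e]
  simp only [Finset.sum_pi_single', Finset.mem_univ, if_true, pow_one, neg_mul, one_mul, neg_neg]
  refine (enorm_integral_le_lintegral_enorm _).trans (le_of_eq ?_)
  congr 1
  funext u
  rw [enorm_mul, Real.enorm_eq_ofReal (φ.nonneg_normed _)]

lemma enorm_clm_apply_le_sum (L : Space d →L[ℝ] ℝ) (v : Space d) :
    ‖L v‖ₑ ≤ ‖v‖ₑ * ∑ i, ‖L (EuclideanSpace.single i 1)‖ₑ := by
  have hv : v = ∑ i, v i • EuclideanSpace.single i (1 : ℝ) := by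
    have := (EuclideanSpace.basisFun (Fin d) ℝ).sum_repr v
    simpa using this.symm
  conv_lhs => rw [hv, map_sum]
  refine (enorm_sum_le _ _).trans ?_
  rw [Finset.mul_sum]
  refine Finset.sum_le_sum fun i _ => ?_
  rw [map_smul, enorm_smul]
  gcongr
  rw [enorm_le_iff_norm_le]
  exact PiLp.norm_apply_le v i

/-- The function `φ * (1_U ∑ᵢ |gᵢ|)`, which dominates the gradient of `mollify φ U w` when `g` is the
weak gradient of `w`. -/
noncomputable def gradMajorant (U : Set (Space d)) (g : Fin d → Space d → ℝ)
    (x : Space d) : ℝ≥0∞ :=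
  ∫⁻ u, U.indicator (fun z => ∑ i, ‖g i z‖ₑ) (x - u)
    ∂(volume.withDensity fun u => ENNReal.ofReal (φ.normed volume u))

lemma measurable_gradient {g : Fin d → Space d → ℝ} (hU : MeasurableSet U)
    (hg : ∀ i, Measurable (g i)) : Measurable (U.indicator fun z => ∑ i, ‖g i z‖ₑ) :=
  (Finset.measurable_fun_sum _ fun i _ => (hg i).enorm).indicator hU

lemma measurable_normed : Measurable fun u : Space d => ENNReal.ofReal (φ.normed volume u) :=
  φ.continuous_normed.measurable.ennreal_ofReal

lemma enorm_fderiv_mollify_le (hU : MeasurableSet U) (hw : Integrable (U.indicator w))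
    {x : Space d} (hx : Metric.closedBall x φ.rOut ⊆ U) {g : Fin d → Space d → ℝ}
    (hgm : ∀ i, Measurable (g i))
    (hg : ∀ i, IsWeakDeriv U (Pi.single i 1) w (g i)) (v : Space d) :
    ‖fderiv ℝ (mollify φ U w) x v‖ₑ ≤ ‖v‖ₑ * gradMajorant φ U g x := by
  refine (enorm_clm_apply_le_sum _ v).trans ?_
  gcongr
  refine (Finset.sum_le_sum fun i _ =>
    enorm_fderiv_mollify_single_le φ hU hw hx (hg i)).trans (le_of_eq ?_)
  have hm : Measurable fun u => ENNReal.ofReal (φ.normed volume (x - u)) :=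
    (measurable_normed φ).comp (measurable_const_sub x)
  have hmul : ∀ i, Measurable fun u => ‖g i u‖ₑ * ENNReal.ofReal (φ.normed volume (x - u)) :=
    fun i => (hgm i).enorm.mul hm
  have hm' : Measurable fun u => U.indicator (fun z => ∑ i, ‖g i z‖ₑ) (x - u) :=
    (measurable_gradient hU hgm).comp (measurable_const_sub x)
  rw [gradMajorant, lintegral_withDensity_eq_lintegral_mul _ (measurable_normed φ) hm',
    ← lintegral_finsetSum _ (fun i _ => hmul i), ← lintegral_indicator hU,
    ← lintegral_sub_left_eq_self _ x]
  congr 1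
  funext u
  by_cases h : x - u ∈ U <;> simp [h, Finset.mul_sum, mul_comm]

lemma measurable_gradMajorant {g : Fin d → Space d → ℝ} (hU : MeasurableSet U)
    (hg : ∀ i, Measurable (g i)) : Measurable (gradMajorant φ U g) :=
  Measurable.lintegral_prod_right'
    ((measurable_gradient hU hg).comp (measurable_fst.sub measurable_snd))

/-- The bump has mass one, so the majorant is an average of translates, all with the same norm. -/
lemma eLpNorm_gradMajorant_le {p : ℝ≥0∞} (hp : 1 ≤ p) {g : Fin d → Space d → ℝ}
    (hU : MeasurableSet U) (hg : ∀ i, Measurable (g i)) :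
    eLpNorm (gradMajorant φ U g) p volume ≤ ∑ i, eLpNorm (g i) p (volume.restrict U) := by
  have : IsProbabilityMeasure
      ((volume : Measure (Space d)).withDensity fun u => ENNReal.ofReal (φ.normed volume u)) := by
    constructor
    rw [withDensity_apply _ MeasurableSet.univ, Measure.restrict_univ,
      ← ofReal_integral_eq_lintegral_ofReal φ.integrable_normed
        (Filter.Eventually.of_forall φ.nonneg_normed), φ.integral_normed, ENNReal.ofReal_one]
  have hG := measurable_gradient hU hg
  refine eLpNorm_lintegral_le (F := fun x u => U.indicator (fun z => ∑ i, ‖g i z‖ₑ) (x - u)) hp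
    (hG.comp (measurable_fst.sub measurable_snd)) (Filter.Eventually.of_forall fun u => ?_)
  have h1 := eLpNorm_comp_measurePreserving (p := p) hG.aestronglyMeasurable
    (measurePreserving_sub_right (volume : Measure (Space d)) u)
  change eLpNorm ((U.indicator (fun z => ∑ i, ‖g i z‖ₑ)) ∘ fun x => x - u) p volume ≤ _
  rw [h1, eLpNorm_indicator_eq_eLpNorm_restrict hU]
  have h2 : (fun z => ∑ i, ‖g i z‖ₑ) = ∑ i, fun z => ‖g i z‖ₑ := by
    funext z; simp
  rw [h2]
  refine (eLpNorm_sum_le (fun i _ => (hg i).enorm.aestronglyMeasurable) hp).trans (le_of_eq ?_)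
  simp

/-- The fundamental theorem of calculus along the segment; `hxy` keeps the whole tube of radius
`rOut` in `U`, where the gradient bound is available. -/
lemma enorm_mollify_sub_le (hU : MeasurableSet U) (hw : Integrable (U.indicator w))
    {g : Fin d → Space d → ℝ} (hgm : ∀ i, Measurable (g i))
    (hg : ∀ i, IsWeakDeriv U (Pi.single i 1) w (g i)) {x y : Space d}
    (hxy : ∀ t ∈ Set.Icc (0 : ℝ) 1, Metric.closedBall (y + t • (x - y)) φ.rOut ⊆ U) :
    ‖mollify φ U w x - mollify φ U w y‖ₑ ≤
      ‖x - y‖ₑ * ∫⁻ t in Set.Ioc (0 : ℝ) 1, gradMajorant φ U g (y + t • (x - y)) := by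
  have hW := contDiff_mollify φ hw
  set f : ℝ → ℝ := fun t => mollify φ U w (y + t • (x - y)) with hf
  set f' : ℝ → ℝ := fun t => fderiv ℝ (mollify φ U w) (y + t • (x - y)) (x - y) with hf'
  have hder : ∀ t, HasDerivAt f (f' t) t := by
    intro t
    have h1 : HasDerivAt (fun t : ℝ => y + t • (x - y)) (x - y) t := by
      simpa using ((hasDerivAt_id t).smul_const (x - y)).const_add y
    exact ((hW.differentiable (by simp) _).hasFDerivAt).comp_hasDerivAt t h1
  have hcont : Continuous f' :=
    ((hW.continuous_fderiv (by simp)).comp (by fun_prop)).clm_apply continuous_const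
  have hftc := intervalIntegral.integral_eq_sub_of_hasDerivAt (a := 0) (b := 1)
    (fun t _ => hder t) (hcont.intervalIntegrable _ _)
  have h01 : f 1 - f 0 = mollify φ U w x - mollify φ U w y := by simp [hf]
  rw [← h01, ← hftc, intervalIntegral.integral_of_le zero_le_one]
  refine (enorm_integral_le_lintegral_enorm _).trans ?_
  rw [← lintegral_const_mul]
  · refine setLIntegral_mono' measurableSet_Ioc fun t ht => ?_
    exact enorm_fderiv_mollify_le φ hU hw (hxy t ⟨ht.1.le, ht.2⟩) hgm hg _
  · exact (measurable_gradMajorant φ hU hgm).comp (by fun_prop)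

end Mollify

/-! ### The Poincaré inequality on a star-shaped domain -/

open Filter Topology in
-- The mollifications converge almost everywhere by Lebesgue differentiation, for which `hφK` keeps
-- the bumps from degenerating, and the segment estimate holds for each of them once the bump radius
-- is small.
lemma ae_enorm_sub_le_liminf {d : ℕ} {U : Set (Space d)} (hU : IsOpen U)
    {φ : ℕ → ContDiffBump (0 : Space d)} (hφ : Tendsto (fun n => (φ n).rOut) atTop (𝓝 0))
    {K : ℝ} (hφK : ∀ n, (φ n).rOut ≤ K * (φ n).rIn)
    {w : Space d → ℝ} (hw : IntegrableOn w U) {g : Fin d → Space d → ℝ}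
    (hgm : ∀ i, Measurable (g i)) (hg : ∀ i, IsWeakDeriv U (Pi.single i 1) w (g i)) :
    ∀ᵐ x ∂(volume.restrict U), ∀ᵐ y ∂(volume.restrict U), segment ℝ y x ⊆ U →
      ‖w x - w y‖ₑ ≤ liminf (fun n => ‖x - y‖ₑ *
        ∫⁻ t in Set.Ioc (0 : ℝ) 1, gradMajorant (φ n) U g (y + t • (x - y))) atTop := by
  have hwi : Integrable (U.indicator w) := (integrable_indicator_iff hU.measurableSet).2 hw
  have hconv : ∀ᵐ x ∂(volume.restrict U),
      Tendsto (fun n => mollify (φ n) U w x) atTop (𝓝 (w x)) := by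
    have h := ContDiffBump.ae_convolution_tendsto_right_of_locallyIntegrable hφ
      (Eventually.of_forall hφK) (μ := volume) hwi.locallyIntegrable
    rw [ae_restrict_iff' hU.measurableSet]
    filter_upwards [h] with x hx hxU
    rwa [Set.indicator_of_mem hxU] at hx
  filter_upwards [hconv] with x hx
  filter_upwards [hconv] with y hy hseg
  have hlim : Tendsto (fun n => ‖mollify (φ n) U w x - mollify (φ n) U w y‖ₑ) atTop
      (𝓝 ‖w x - w y‖ₑ) := (hx.sub hy).enorm
  rw [← hlim.liminf_eq]
  have hcomp : IsCompact (segment ℝ y x) := by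
    rw [segment_eq_image_lineMap]
    exact isCompact_Icc.image AffineMap.lineMap_continuous
  -- A compact segment in an open set has a neighbourhood of uniform width inside it, which contains
  -- the tube for all large `n`.
  obtain ⟨δ, hδ, hδU⟩ := hcomp.exists_cthickening_subset_open hU hseg
  refine liminf_le_liminf ?_
  filter_upwards [hφ.eventually (gt_mem_nhds hδ)] with n hn
  refine enorm_mollify_sub_le (φ n) hU.measurableSet hwi hgm hg fun t ht z hz => hδU ?_
  have hmem : y + t • (x - y) ∈ segment ℝ y x := by
    rw [segment_eq_image']
    exact ⟨t, ht, rfl⟩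
  exact Metric.mem_cthickening_of_dist_le z _ δ _ hmem ((Metric.mem_closedBall.1 hz).trans hn.le)

lemma eLpNorm_ofReal_mul_le {X : Type*} [MeasurableSpace X] {μ : Measure X} {p : ℝ≥0∞} (c : ℝ)
    (f : X → ℝ≥0∞) :
    eLpNorm (fun x => ENNReal.ofReal c * f x) p μ ≤ ENNReal.ofReal c * eLpNorm f p μ :=
  eLpNorm_le_nnreal_smul_eLpNorm_of_ae_le_mul' (c := c.toNNReal)
    (Filter.Eventually.of_forall fun _ => le_rfl) p

lemma poincare_of_measurable {d : ℕ} {U B : Set (Space d)} (hU : IsOpen U)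
    (hUb : Bornology.IsBounded U) (hBU : B ⊆ U) (hBm : MeasurableSet B) (hB0 : volume B ≠ 0)
    (hstar : ∀ y ∈ B, StarConvex ℝ y U) {p : ℝ≥0∞} (hp : 1 ≤ p) {A : ℝ≥0∞} (hA : 1 ≤ A)
    (hUB : volume U ≤ A * volume B) {w : Space d → ℝ} (hw : IntegrableOn w U)
    (hmean : ∫ y in B, w y = 0) {g : Fin d → Space d → ℝ} (hgm : ∀ i, Measurable (g i))
    (hg : ∀ i, IsWeakDeriv U (Pi.single i 1) w (g i)) :
    eLpNorm w p (volume.restrict U) ≤ ENNReal.ofReal (Metric.diam U) * (2 ^ (d + 1) * A) *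
      ∑ i, eLpNorm (g i) p (volume.restrict U) := by
  have hBt : volume B ≠ ⊤ := ((hUb.subset hBU).measure_lt_top).ne
  have : IsProbabilityMeasure (ProbabilityTheory.cond volume B) :=
    ProbabilityTheory.cond_isProbabilityMeasure_of_finite hB0 hBt
  set φ : ℕ → ContDiffBump (0 : Space d) := fun n =>
    ⟨1 / ((n : ℝ) + 1), 2 * (1 / ((n : ℝ) + 1)), by positivity,
      by have : 0 < 1 / ((n : ℝ) + 1) := by positivity
         linarith⟩ with hφdef
  have hφ : Filter.Tendsto (fun n => (φ n).rOut) Filter.atTop (nhds 0) := by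
    simpa [hφdef] using (tendsto_one_div_add_atTop_nhds_zero_nat (𝕜 := ℝ)).const_mul 2
  have hφK : ∀ n, (φ n).rOut ≤ 2 * (φ n).rIn := fun n => le_rfl
  set D := ENNReal.ofReal (Metric.diam U) with hD
  set R : ℕ → Space d → Space d → ℝ≥0∞ := fun n x y =>
    ∫⁻ t in Set.Ioc (0 : ℝ) 1, gradMajorant (φ n) U g (y + t • (x - y)) with hR
  have hRm : ∀ n, Measurable (Function.uncurry (R n)) := by
    intro n
    exact Measurable.lintegral_prod_right' (f := fun z : (Space d × Space d) × ℝ =>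
      gradMajorant (φ n) U g (z.1.2 + z.2 • (z.1.1 - z.1.2)))
      ((measurable_gradMajorant (φ n) hU.measurableSet hgm).comp (by fun_prop))
  have hRy : ∀ n x, Measurable (R n x) := fun n x => (hRm n).of_uncurry_left
  have hpt : ∀ᵐ x ∂(volume.restrict U), ‖w x‖ₑ ≤ Filter.liminf (fun n =>
      D * ∫⁻ y, R n x y ∂(ProbabilityTheory.cond volume B)) Filter.atTop := by
    filter_upwards [ae_enorm_sub_le_liminf hU hφ hφK hw hgm hg, ae_restrict_mem hU.measurableSet]
      with x hx hxU
    have hwB : Integrable w (ProbabilityTheory.cond volume B) :=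
      (hw.mono_set hBU).smul_measure (ENNReal.inv_ne_top.2 hB0)
    -- The only place where the zero mean enters.
    have h1 : w x = ∫ y, (w x - w y) ∂(ProbabilityTheory.cond volume B) := by
      have hint : ∫ y, w y ∂(ProbabilityTheory.cond volume B) = 0 := by
        simp [ProbabilityTheory.cond, integral_smul_measure, hmean]
      rw [integral_sub (integrable_const _) hwB, hint]
      simp
    have h2 : ∀ᵐ y ∂(ProbabilityTheory.cond volume B), ‖w x - w y‖ₑ ≤
        Filter.liminf (fun n => D * R n x y) Filter.atTop := by
      refine Measure.ae_smul_measure ?_ _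
      filter_upwards [ae_restrict_of_ae_restrict_of_subset hBU hx, ae_restrict_mem hBm]
        with y hy hyB
      refine (hy ((hstar y hyB).segment_subset hxU)).trans
        (Filter.liminf_le_liminf (Filter.Eventually.of_forall fun n => ?_))
      gcongr
      rw [← ofReal_norm, ← dist_eq_norm]
      exact ENNReal.ofReal_le_ofReal (Metric.dist_le_diam_of_mem hUb hxU (hBU hyB))
    rw [h1]
    calc ‖∫ y, (w x - w y) ∂(ProbabilityTheory.cond volume B)‖ₑ
        ≤ ∫⁻ y, ‖w x - w y‖ₑ ∂(ProbabilityTheory.cond volume B) :=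
          enorm_integral_le_lintegral_enorm _
      _ ≤ ∫⁻ y, Filter.liminf (fun n => D * R n x y) Filter.atTop
            ∂(ProbabilityTheory.cond volume B) := lintegral_mono_ae h2
      _ ≤ Filter.liminf (fun n => ∫⁻ y, D * R n x y ∂(ProbabilityTheory.cond volume B))
            Filter.atTop := lintegral_liminf_le fun n =>
              (hRy n x).const_mul D
      _ = _ := by
          congr 1
          funext n
          exact lintegral_const_mul D (hRy n x)
  refine (eLpNorm_mono_enorm_ae (g := fun x => Filter.liminf (fun n =>
      D * ∫⁻ y, R n x y ∂(ProbabilityTheory.cond volume B)) Filter.atTop) hpt).trans ?_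
  have hIm : ∀ n, Measurable fun x => D * ∫⁻ y, R n x y ∂(ProbabilityTheory.cond volume B) := by
    intro n
    clear_value R
    exact (Measurable.lintegral_prod_right' (hRm n)).const_mul D
  have hbound : ∀ n, eLpNorm (fun x => D * ∫⁻ y, R n x y ∂(ProbabilityTheory.cond volume B)) p
      (volume.restrict U) ≤ D * (2 ^ (d + 1) * A) * ∑ i, eLpNorm (g i) p (volume.restrict U) := by
    intro n
    refine (eLpNorm_ofReal_mul_le _ _).trans ?_
    rw [mul_assoc]
    refine mul_le_mul_right (?_ : _ ≤ 2 ^ (d + 1) * A * _) D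
    refine (eLpNorm_average_segment_le hp (measurable_gradMajorant (φ n) hU.measurableSet hgm) hB0
      hBt hA hUB).trans ?_
    gcongr
    exact eLpNorm_gradMajorant_le (φ n) hp hU.measurableSet hgm
  exact eLpNorm_liminf_le hp hIm hbound

/-- **Poincaré inequality** on a domain `U` that is star-shaped with respect to every point of `B`,
for functions with zero mean over `B`. -/
theorem poincare {d : ℕ} {U B : Set (Space d)} (hU : IsOpen U)
    (hUb : Bornology.IsBounded U) (hBU : B ⊆ U) (hBm : MeasurableSet B) (hB0 : volume B ≠ 0)
    (hstar : ∀ y ∈ B, StarConvex ℝ y U) {p : ℝ≥0∞} (hp : 1 ≤ p) {A : ℝ≥0∞} (hA : 1 ≤ A)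
    (hUB : volume U ≤ A * volume B) {w : Space d → ℝ} (hw : IntegrableOn w U)
    (hmean : ∫ y in B, w y = 0) {g : Fin d → Space d → ℝ}
    (hgm : ∀ i, AEStronglyMeasurable (g i) (volume.restrict U))
    (hg : ∀ i, IsWeakDeriv U (Pi.single i 1) w (g i)) :
    eLpNorm w p (volume.restrict U) ≤ ENNReal.ofReal (Metric.diam U) * (2 ^ (d + 1) * A) *
      ∑ i, eLpNorm (g i) p (volume.restrict U) := by
  refine (poincare_of_measurable hU hUb hBU hBm hB0 hstar hp hA hUB hw hmean
    (fun i => (hgm i).stronglyMeasurable_mk.measurable)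
    (fun i => (hg i).congr_right (hgm i).ae_eq_mk)).trans (le_of_eq ?_)
  congr 1
  exact Finset.sum_congr rfl fun i _ => eLpNorm_congr_ae (hgm i).ae_eq_mk.symm

/-! ### Polynomial functions -/

/-- The function on `ℝ^d` defined by a polynomial. -/
noncomputable def polyFun (d : ℕ) : MvPolynomial (Fin d) ℝ →ₗ[ℝ] (Space d → ℝ) where
  toFun P := fun x => MvPolynomial.eval (fun i => x i) P
  map_add' P Q := by funext x; simp
  map_smul' c P := by funext x; simp

lemma polyFun_apply {d : ℕ} (P : MvPolynomial (Fin d) ℝ) (x : Space d) :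
    polyFun d P x = MvPolynomial.eval (fun i => x i) P := rfl

lemma polyFun_mul {d : ℕ} (P Q : MvPolynomial (Fin d) ℝ) :
    polyFun d (P * Q) = polyFun d P * polyFun d Q := by
  funext x; simp [polyFun_apply]

lemma polyFun_C {d : ℕ} (c : ℝ) : polyFun d (MvPolynomial.C c) = fun _ => c := by
  funext x; simp [polyFun_apply]

lemma polyFun_X {d : ℕ} (i : Fin d) : polyFun d (MvPolynomial.X i) = fun x => x i := by
  funext x; simp [polyFun_apply]

lemma contDiff_polyFun {d : ℕ} (P : MvPolynomial (Fin d) ℝ) : ContDiff ℝ ∞ (polyFun d P) := by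
  induction P using MvPolynomial.induction_on with
  | C c => rw [polyFun_C]; exact contDiff_const
  | add P Q hP hQ => rw [map_add]; exact hP.add hQ
  | mul_X P i hP =>
    rw [polyFun_mul, polyFun_X]
    exact hP.mul ((EuclideanSpace.proj (𝕜 := ℝ) i).contDiff)

lemma partialDeriv_add {d : ℕ} {f g : Space d → ℝ} (hf : ContDiff ℝ ∞ f) (hg : ContDiff ℝ ∞ g)
    (i : Fin d) : partialDeriv i (f + g) = partialDeriv i f + partialDeriv i g := by
  funext x
  simp only [partialDeriv, Pi.add_apply]
  rw [fderiv_add (hf.differentiable (by simp) x) (hg.differentiable (by simp) x)]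
  rfl

lemma partialDeriv_smul {d : ℕ} {f : Space d → ℝ} (hf : ContDiff ℝ ∞ f) (c : ℝ)
    (i : Fin d) : partialDeriv i (c • f) = c • partialDeriv i f := by
  funext x
  simp only [partialDeriv, Pi.smul_apply]
  rw [fderiv_const_smul (hf.differentiable (by simp) x)]
  rfl

lemma multiDeriv_add {d : ℕ} {f g : Space d → ℝ} (hf : ContDiff ℝ ∞ f) (hg : ContDiff ℝ ∞ g)
    (α : Fin d → ℕ) : multiDeriv α (f + g) = multiDeriv α f + multiDeriv α g := by
  induction α using multiIndex_induction with
  | zero => simp [multiDeriv_zero]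
  | step α i ih =>
    have hfg : ContDiff ℝ ∞ (f + g) := hf.add hg
    rw [multiDeriv_add_single hfg, ih, partialDeriv_add (hf.multiDeriv α) (hg.multiDeriv α),
      multiDeriv_add_single hf, multiDeriv_add_single hg]

lemma multiDeriv_smul {d : ℕ} {f : Space d → ℝ} (hf : ContDiff ℝ ∞ f) (c : ℝ)
    (α : Fin d → ℕ) : multiDeriv α (c • f) = c • multiDeriv α f := by
  induction α using multiIndex_induction with
  | zero => simp [multiDeriv_zero]
  | step α i ih =>
    have hcf : ContDiff ℝ ∞ (c • f) := contDiff_const.smul hf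
    rw [multiDeriv_add_single hcf, ih, partialDeriv_smul (hf.multiDeriv α),
      multiDeriv_add_single hf]

lemma multiDeriv_const_zero {d : ℕ} (α : Fin d → ℕ) : multiDeriv α (0 : Space d → ℝ) = 0 := by
  simpa using multiDeriv_smul (contDiff_const (c := (0 : ℝ)) (E := Space d)) 0 α

lemma partialDeriv_polyFun {d : ℕ} (i : Fin d) (P : MvPolynomial (Fin d) ℝ) :
    partialDeriv i (polyFun d P) = polyFun d (MvPolynomial.pderiv i P) := by
  induction P using MvPolynomial.induction_on with
  | C c => funext x; simp [polyFun_C, partialDeriv]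
  | add P Q hP hQ =>
    rw [map_add, partialDeriv_add (contDiff_polyFun P) (contDiff_polyFun Q), hP, hQ, map_add,
      map_add]
  | mul_X P j hP =>
    funext x
    have hd := (contDiff_polyFun P).differentiable (by simp) x
    have hx : HasFDerivAt (fun x : Space d => x j)
        (EuclideanSpace.proj j : Space d →L[ℝ] ℝ) x :=
      (EuclideanSpace.proj (𝕜 := ℝ) j : Space d →L[ℝ] ℝ).hasFDerivAt
    have hP' := congrFun hP x
    simp only [partialDeriv] at hP' ⊢
    rw [polyFun_mul, polyFun_X, (hd.hasFDerivAt.mul hx).fderiv, Derivation.leibniz, map_add,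
      smul_eq_mul, smul_eq_mul, polyFun_mul, polyFun_mul, polyFun_X, MvPolynomial.pderiv_X]
    simp only [add_apply, smul_apply, smul_eq_mul, hP', Pi.add_apply, Pi.mul_apply]
    rcases eq_or_ne i j with rfl | hij
    · simp [polyFun_apply]
    · simp [polyFun_apply, hij.symm]

lemma totalDegree_pderiv_le {σ R : Type*} [CommSemiring R] (i : σ) (P : MvPolynomial σ R) :
    (MvPolynomial.pderiv i P).totalDegree ≤ P.totalDegree - 1 := by
  classical
  conv_lhs => rw [P.as_sum, map_sum]
  refine MvPolynomial.totalDegree_finsetSum_le fun u hu => ?_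
  rw [MvPolynomial.pderiv_monomial]
  rcases Nat.eq_zero_or_pos (u i) with h | h
  · simp [h]
  · refine (MvPolynomial.totalDegree_monomial_le _ _).trans ?_
    have h1 := MvPolynomial.le_totalDegree hu
    have h2 : (u - Finsupp.single i 1) + Finsupp.single i 1 = u :=
      tsub_add_cancel_of_le (Finsupp.single_le_iff.2 h)
    have h3 := congrArg Finsupp.degree h2
    rw [map_add, Finsupp.degree_single] at h3
    have h4 : u.sum (fun _ e => e) = u.degree := rfl
    have h5 : (u - Finsupp.single i 1).sum (fun _ e => e) = (u - Finsupp.single i 1).degree := rfl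
    change (u - Finsupp.single i 1).sum (fun _ e => e) ≤ _
    omega

lemma exists_multiDeriv_polyFun_eq {d : ℕ} (P : MvPolynomial (Fin d) ℝ) (α : Fin d → ℕ) :
    ∃ R : MvPolynomial (Fin d) ℝ, multiDeriv α (polyFun d P) = polyFun d R ∧
      R.totalDegree ≤ P.totalDegree - ∑ i, α i := by
  induction α using multiIndex_induction with
  | zero => exact ⟨P, multiDeriv_zero _, by simp⟩
  | step α i ih =>
    obtain ⟨R, hR, hdeg⟩ := ih
    refine ⟨MvPolynomial.pderiv i R, ?_, ?_⟩
    · rw [multiDeriv_add_single (contDiff_polyFun P), hR, partialDeriv_polyFun]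
    · rw [sum_add_single]
      have := totalDegree_pderiv_le i R
      omega

/-- One derivative is set aside; the others already reduce the polynomial to a constant. -/
lemma multiDeriv_polyFun_eq_zero {d : ℕ} {P : MvPolynomial (Fin d) ℝ} {α : Fin d → ℕ}
    (h : P.totalDegree < ∑ i, α i) : multiDeriv α (polyFun d P) = 0 := by
  obtain ⟨i, -, hi⟩ := Finset.exists_ne_zero_of_sum_ne_zero (Nat.ne_zero_of_lt h)
  obtain ⟨β, rfl⟩ := exists_eq_add_single hi
  rw [sum_add_single] at h
  obtain ⟨R, hR, hdeg⟩ := exists_multiDeriv_polyFun_eq P β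
  have h0 : R.totalDegree = 0 := by omega
  rw [multiDeriv_add_single (contDiff_polyFun P), hR, partialDeriv_polyFun,
    MvPolynomial.totalDegree_eq_zero_iff_eq_C.1 h0, MvPolynomial.pderiv_C, map_zero]

/-- The monomial `X^α`. -/
noncomputable def multiMonomial {d : ℕ} (α : Fin d → ℕ) : MvPolynomial (Fin d) ℝ :=
  MvPolynomial.monomial (Finsupp.equivFunOnFinite.symm α) 1

lemma totalDegree_multiMonomial_le {d : ℕ} (α : Fin d → ℕ) :
    (multiMonomial α).totalDegree ≤ ∑ i, α i := by
  refine (MvPolynomial.totalDegree_monomial_le _ _).trans (le_of_eq ?_)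
  rw [Finsupp.sum_fintype _ _ (fun _ => rfl)]
  rfl

lemma pderiv_multiMonomial_of_eq_zero {d : ℕ} {α : Fin d → ℕ} {i : Fin d} (h : α i = 0) :
    MvPolynomial.pderiv i (multiMonomial α) = 0 := by
  rw [multiMonomial, MvPolynomial.pderiv_monomial]
  simp [h]

lemma pderiv_multiMonomial_add_single {d : ℕ} (α : Fin d → ℕ) (i : Fin d) :
    MvPolynomial.pderiv i (multiMonomial (α + Pi.single i 1)) =
      ((α i : ℝ) + 1) • multiMonomial α := by
  have hs : Finsupp.equivFunOnFinite.symm (α + Pi.single i 1) - Finsupp.single i 1 =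
      Finsupp.equivFunOnFinite.symm α := by
    ext j
    rcases eq_or_ne j i with rfl | hj
    · simp
    · simp [hj]
  rw [multiMonomial, MvPolynomial.pderiv_monomial, multiMonomial, MvPolynomial.smul_monomial, hs]
  simp

/-- The constant built by the induction is `β!`. On monomials of a fixed degree the derivatives of
that order act diagonally, so their values can be prescribed independently. -/
lemma exists_multiDeriv_multiMonomial {d : ℕ} (β : Fin d → ℕ) :
    ∃ c : ℝ, c ≠ 0 ∧ ∀ α : Fin d → ℕ, ∑ i, α i = ∑ i, β i →
      multiDeriv β (polyFun d (multiMonomial α)) = fun _ => if α = β then c else 0 := by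
  induction β using multiIndex_induction with
  | zero =>
    refine ⟨1, one_ne_zero, fun α hα => ?_⟩
    have : α = 0 := by
      funext i
      exact Finset.sum_eq_zero_iff.mp (hα.trans (by simp)) i (Finset.mem_univ i)
    subst this
    rw [multiDeriv_zero]
    funext x
    simp [polyFun_apply, multiMonomial, MvPolynomial.eval_monomial]
  | step β i ih =>
    obtain ⟨c, hc, h⟩ := ih
    refine ⟨((β i : ℝ) + 1) * c, mul_ne_zero (by positivity) hc, fun α hα => ?_⟩
    rw [multiDeriv_add_single (contDiff_polyFun _), ← multiDeriv_partialDeriv (contDiff_polyFun _),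
      partialDeriv_polyFun]
    by_cases hi : α i = 0
    · have hne : α ≠ β + Pi.single i 1 := by
        rintro rfl
        simp at hi
      rw [pderiv_multiMonomial_of_eq_zero hi, map_zero, multiDeriv_const_zero]
      simp only [hne, if_false]
      rfl
    · obtain ⟨α, rfl⟩ := exists_eq_add_single hi
      rw [sum_add_single, sum_add_single] at hα
      rw [pderiv_multiMonomial_add_single, map_smul, multiDeriv_smul (contDiff_polyFun _),
        h α (by omega)]
      funext x
      by_cases hαβ : α = β
      · subst hαβ; simp
      · simp [hαβ]

lemma integrableOn_of_contDiff {d : ℕ} {f : Space d → ℝ} (hf : ContDiff ℝ ∞ f)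
    {B : Set (Space d)} (hB : Bornology.IsBounded B) : IntegrableOn f B :=
  (hf.continuous.locallyIntegrable.integrableOn_isCompact hB.isCompact_closure).mono_set
    subset_closure

/-- There is a polynomial of degree less than `k` whose derivatives of order less than `k` have
prescribed integrals over a bounded set `B` of positive measure. -/
lemma exists_polynomial_integral_multiDeriv {d : ℕ} {B : Set (Space d)}
    (hB : Bornology.IsBounded B) (hB0 : volume B ≠ 0) (k : ℕ) (a : (Fin d → ℕ) → ℝ) :
    ∃ Q : MvPolynomial (Fin d) ℝ, Q.totalDegree ≤ k - 1 ∧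
      (∀ β : Fin d → ℕ, k ≤ ∑ i, β i → multiDeriv β (polyFun d Q) = 0) ∧
      ∀ α : Fin d → ℕ, ∑ i, α i < k → ∫ x in B, multiDeriv α (polyFun d Q) x = a α := by
  have hBv : volume.real B ≠ 0 := (ENNReal.toReal_ne_zero).2 ⟨hB0, hB.measure_lt_top.ne⟩
  induction k generalizing a with
  | zero =>
    -- With truncated subtraction the degree bound would still allow a nonzero constant when `k =
    -- 0`; the vanishing clause excludes it.
    refine ⟨0, by simp, fun β _ => ?_, fun α hα => absurd hα (by simp)⟩
    rw [map_zero, multiDeriv_const_zero]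
  | succ k ih =>
    choose c hc0 hc using fun β : Fin d → ℕ => exists_multiDeriv_multiMonomial β
    -- The coefficients make `∂^α Q₀` the constant `a α / |B|` for each `α` of order `k`. The
    -- correction `Q₁` then repairs the lower orders; its own derivatives of order `k` vanish.
    set Q₀ : MvPolynomial (Fin d) ℝ := ∑ α ∈ Finset.piAntidiag (Finset.univ : Finset (Fin d)) k,
      (a α / (c α * volume.real B)) • multiMonomial α with hQ₀
    obtain ⟨Q₁, hdeg₁, hzero₁, hint₁⟩ :=
      ih fun α => a α - ∫ x in B, multiDeriv α (polyFun d Q₀) x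
    have hdeg₀ : Q₀.totalDegree ≤ k := by
      refine MvPolynomial.totalDegree_finsetSum_le fun α hα => ?_
      refine (MvPolynomial.totalDegree_smul_le _ _).trans ((totalDegree_multiMonomial_le α).trans ?_)
      exact (Finset.mem_piAntidiag.1 hα).1.le
    have htop : ∀ β : Fin d → ℕ, ∑ i, β i = k →
        multiDeriv β (polyFun d Q₀) = fun _ => a β / volume.real B := by
      intro β hβ
      have hsum : ∀ S ⊆ Finset.piAntidiag (Finset.univ : Finset (Fin d)) k,
          multiDeriv β (polyFun d (∑ α ∈ S, (a α / (c α * volume.real B)) • multiMonomial α)) =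
          fun _ => ∑ α ∈ S, if α = β then a β / volume.real B else 0 := by
        intro S
        induction S using Finset.induction_on with
        | empty => intro _; simp only [Finset.sum_empty, map_zero, multiDeriv_const_zero]; rfl
        | insert α S hα hS =>
          intro hsub
          have hαk := (Finset.mem_piAntidiag.1 (hsub (Finset.mem_insert_self α S))).1
          rw [Finset.sum_insert hα, map_add, multiDeriv_add (contDiff_polyFun _)
            (contDiff_polyFun _), hS ((Finset.subset_insert α S).trans hsub), map_smul,
            multiDeriv_smul (contDiff_polyFun _), hc β α (hαk.trans hβ.symm)]
          funext x
          simp only [Pi.add_apply, Pi.smul_apply, smul_eq_mul, Finset.sum_insert hα]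
          congr 1
          by_cases h : α = β
          · subst h
            have := hc0 α
            simp only [if_true]
            field_simp
          · simp [h]
      rw [hQ₀, hsum _ subset_rfl]
      have hmem : β ∈ Finset.piAntidiag (Finset.univ : Finset (Fin d)) k := by
        rw [Finset.mem_piAntidiag]; exact ⟨hβ, by simp⟩
      funext x
      rw [Finset.sum_ite_eq', if_pos hmem]
    have hadd : ∀ β, multiDeriv β (polyFun d (Q₀ + Q₁)) =
        multiDeriv β (polyFun d Q₀) + multiDeriv β (polyFun d Q₁) := fun β => by
      rw [map_add, multiDeriv_add (contDiff_polyFun _) (contDiff_polyFun _)]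
    refine ⟨Q₀ + Q₁, ?_, fun β hβ => ?_, fun α hα => ?_⟩
    · exact (MvPolynomial.totalDegree_add _ _).trans (max_le hdeg₀ (by omega))
    · rw [hadd, hzero₁ β (by omega), multiDeriv_polyFun_eq_zero (by omega), add_zero]
    · rw [hadd]
      simp only [Pi.add_apply]
      rw [integral_add
        (integrableOn_of_contDiff ((contDiff_polyFun _).multiDeriv α) hB)
        (integrableOn_of_contDiff ((contDiff_polyFun _).multiDeriv α) hB)]
      rcases Nat.lt_succ_iff_lt_or_eq.1 hα with h | h
      · rw [hint₁ α h]; ring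
      · rw [hzero₁ α h.ge, htop α h]
        simp only [Pi.zero_apply, integral_zero, add_zero, integral_const, smul_eq_mul,
          measureReal_restrict_apply_univ]
        field_simp

/-! ### Sobolev seminorms -/

/-- All weak derivatives of `v` of order at most `s` exist and belong to `L^p(U)`. -/
def HasWeakDerivs {d : ℕ} (U : Set (Space d)) (s : ℕ) (p : ℝ≥0∞) (v : Space d → ℝ) : Prop :=
  ∀ α : Fin d → ℕ, ∑ i, α i ≤ s →
    ∃ g : Space d → ℝ, MemLp g p (volume.restrict U) ∧ IsWeakDeriv U α v g

section

variable {d : ℕ} {U : Set (Space d)} {s : ℕ} {p : ℝ≥0∞} {v w : Space d → ℝ}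

lemma HasWeakDerivs.mono {r : ℕ} (hv : HasWeakDerivs U s p v) (h : r ≤ s) :
    HasWeakDerivs U r p v := fun α hα => hv α (hα.trans h)

lemma HasWeakDerivs.congr (h : v =ᵐ[volume.restrict U] w) (hv : HasWeakDerivs U s p v) :
    HasWeakDerivs U s p w := fun α hα => by
  obtain ⟨g, hg, hvg⟩ := hv α hα
  exact ⟨g, hg, hvg.congr h⟩

lemma HasWeakDerivs.sub (hv : HasWeakDerivs U s p v) (hw : HasWeakDerivs U s p w) :
    HasWeakDerivs U s p (v - w) := fun α hα => by
  obtain ⟨g, hg, hvg⟩ := hv α hα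
  obtain ⟨k, hk, hwk⟩ := hw α hα
  exact ⟨g - k, hg.sub hk, hvg.sub hwk⟩

lemma HasWeakDerivs.isWeakDeriv (hv : HasWeakDerivs U s p v) {α : Fin d → ℕ}
    (hα : ∑ i, α i ≤ s) : IsWeakDeriv U α v (weakDeriv U α v) := by
  obtain ⟨g, -, hvg⟩ := hv α hα
  exact hvg.isWeakDeriv_weakDeriv

lemma HasWeakDerivs.memLp (hU : IsOpen U) (hv : HasWeakDerivs U s p v) {α : Fin d → ℕ}
    (hα : ∑ i, α i ≤ s) : MemLp (weakDeriv U α v) p (volume.restrict U) := by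
  obtain ⟨g, hg, hvg⟩ := hv α hα
  exact hg.ae_eq (hvg.weakDeriv_ae_eq hU).symm

lemma memLp_of_contDiff (hUb : Bornology.IsBounded U) {f : Space d → ℝ} (hf : ContDiff ℝ ∞ f)
    (p : ℝ≥0∞) : MemLp f p (volume.restrict U) := by
  have : IsFiniteMeasure (volume.restrict U) := ⟨by simpa using hUb.measure_lt_top⟩
  obtain ⟨C, hC⟩ := hUb.isCompact_closure.exists_bound_of_continuousOn
    (hf.continuous.continuousOn (s := closure U))
  refine MemLp.of_bound hf.continuous.aestronglyMeasurable C ?_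
  exact ae_restrict_of_ae_restrict_of_subset subset_closure
    (ae_restrict_of_forall_mem isClosed_closure.measurableSet hC)

lemma hasWeakDerivs_of_contDiff (hUb : Bornology.IsBounded U) {f : Space d → ℝ}
    (hf : ContDiff ℝ ∞ f) (s : ℕ) (p : ℝ≥0∞) : HasWeakDerivs U s p f := fun α _ =>
  ⟨multiDeriv α f, memLp_of_contDiff hUb (hf.multiDeriv α) p, isWeakDeriv_multiDeriv U hf α⟩

/-- The two functions have the same set of weak derivatives, so the same one is chosen: the equality
holds everywhere and not just almost everywhere. -/
lemma weakDeriv_congr (h : v =ᵐ[volume.restrict U] w) (α : Fin d → ℕ) :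
    weakDeriv U α v = weakDeriv U α w := by
  have : IsWeakDeriv U α v = IsWeakDeriv U α w := by
    funext g
    exact propext ⟨fun hg => hg.congr h, fun hg => hg.congr h.symm⟩
  unfold weakDeriv
  rw [this]

lemma sobolevSeminorm_congr (h : v =ᵐ[volume.restrict U] w) (s : ℕ) (p : ℝ≥0∞) :
    sobolevSeminorm U s p v = sobolevSeminorm U s p w := by
  unfold sobolevSeminorm
  simp_rw [weakDeriv_congr h]

lemma weakDeriv_sub_ae_eq (hU : IsOpen U) (hv : HasWeakDerivs U s p v)
    (hw : HasWeakDerivs U s p w) {α : Fin d → ℕ} (hα : ∑ i, α i ≤ s) :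
    weakDeriv U α (v - w) =ᵐ[volume.restrict U] weakDeriv U α v - weakDeriv U α w :=
  ((hv.isWeakDeriv hα).sub (hw.isWeakDeriv hα)).weakDeriv_ae_eq hU

lemma weakDeriv_ae_eq_multiDeriv (hU : IsOpen U) {f : Space d → ℝ} (hf : ContDiff ℝ ∞ f)
    (α : Fin d → ℕ) : weakDeriv U α f =ᵐ[volume.restrict U] multiDeriv α f :=
  (isWeakDeriv_multiDeriv U hf α).weakDeriv_ae_eq hU

lemma sobolevSeminorm_sub_le (hU : IsOpen U) (hp : 1 ≤ p) (hv : HasWeakDerivs U s p v)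
    (hw : HasWeakDerivs U s p w) :
    sobolevSeminorm U s p (v - w) ≤ sobolevSeminorm U s p v + sobolevSeminorm U s p w := by
  unfold sobolevSeminorm
  rw [← Finset.sum_add_distrib]
  refine Finset.sum_le_sum fun α hα => ?_
  have hαs := (Finset.mem_piAntidiag.1 hα).1.le
  rw [eLpNorm_congr_ae (weakDeriv_sub_ae_eq hU hv hw hαs)]
  exact eLpNorm_sub_le (hv.memLp hU hαs).1 (hw.memLp hU hαs).1 hp

lemma sobolevSeminorm_of_contDiff (hU : IsOpen U) {f : Space d → ℝ} (hf : ContDiff ℝ ∞ f)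
    (s : ℕ) (p : ℝ≥0∞) : sobolevSeminorm U s p f =
      ∑ α ∈ Finset.piAntidiag (Finset.univ : Finset (Fin d)) s,
        eLpNorm (multiDeriv α f) p (volume.restrict U) :=
  Finset.sum_congr rfl fun α _ => eLpNorm_congr_ae (weakDeriv_ae_eq_multiDeriv hU hf α)

lemma mem_piAntidiag_univ {α : Fin d → ℕ} :
    α ∈ Finset.piAntidiag (Finset.univ : Finset (Fin d)) s ↔ ∑ i, α i = s := by
  simp [Finset.mem_piAntidiag]

/-- For each fixed `i` the shift is injective into the indices of order `r + 1`, so every direction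
contributes at most one copy of the sum. -/
lemma sum_piAntidiag_add_single_le (f : (Fin d → ℕ) → ℝ≥0∞) (r : ℕ) :
    ∑ α ∈ Finset.piAntidiag (Finset.univ : Finset (Fin d)) r, ∑ i, f (α + Pi.single i 1) ≤
      d * ∑ β ∈ Finset.piAntidiag (Finset.univ : Finset (Fin d)) (r + 1), f β := by
  rw [Finset.sum_comm]
  refine (Finset.sum_le_card_nsmul _ _ (∑ β ∈ Finset.piAntidiag Finset.univ (r + 1), f β)
    fun i _ => ?_).trans (by simp)
  rw [← Finset.sum_image (s := Finset.piAntidiag Finset.univ r)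
    (g := fun α : Fin d → ℕ => α + Pi.single i 1) (f := f) fun α _ β _ h => add_right_cancel h]
  refine Finset.sum_le_sum_of_subset fun β hβ => ?_
  obtain ⟨α, hα, rfl⟩ := Finset.mem_image.1 hβ
  rw [mem_piAntidiag_univ] at hα ⊢
  rw [sum_add_single, hα]

lemma sobolevSeminorm_le_succ {B : Set (Space d)} (hU : IsOpen U)
    (hUb : Bornology.IsBounded U) (hBU : B ⊆ U) (hBm : MeasurableSet B) (hB0 : volume B ≠ 0)
    (hstar : ∀ y ∈ B, StarConvex ℝ y U) (hp : 1 ≤ p) {A : ℝ≥0∞} (hA : 1 ≤ A)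
    (hUB : volume U ≤ A * volume B) {r : ℕ} (hv : HasWeakDerivs U (r + 1) p v)
    (hmean : ∀ α : Fin d → ℕ, ∑ i, α i = r → ∫ x in B, weakDeriv U α v x = 0) :
    sobolevSeminorm U r p v ≤
      ENNReal.ofReal (Metric.diam U) * (2 ^ (d + 1) * A * d) * sobolevSeminorm U (r + 1) p v := by
  have : IsFiniteMeasure (volume.restrict U) := ⟨by simpa using hUb.measure_lt_top⟩
  set K := ENNReal.ofReal (Metric.diam U) * (2 ^ (d + 1) * A) with hK
  calc sobolevSeminorm U r p v
      ≤ ∑ α ∈ Finset.piAntidiag (Finset.univ : Finset (Fin d)) r, K * ∑ i,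
          eLpNorm (weakDeriv U (α + Pi.single i 1) v) p (volume.restrict U) := by
        refine Finset.sum_le_sum fun α hα => ?_
        have hαr := mem_piAntidiag_univ.1 hα
        have hle : ∀ i, ∑ j, (α + Pi.single i 1 : Fin d → ℕ) j ≤ r + 1 := fun i => by
          rw [sum_add_single, hαr]
        have hαr' : ∑ i, α i ≤ r + 1 := by omega
        exact poincare hU hUb hBU hBm hB0 hstar hp hA hUB ((hv.memLp hU hαr').integrable hp)
          (hmean α hαr) (fun i => (hv.memLp hU (hle i)).1)
          fun i => (hv.isWeakDeriv hαr').of_add_single (hv.isWeakDeriv (hle i))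
    _ ≤ K * (d * sobolevSeminorm U (r + 1) p v) := by
        rw [← Finset.mul_sum]
        gcongr
        exact sum_piAntidiag_add_single_le
          (fun β => eLpNorm (weakDeriv U β v) p (volume.restrict U)) r
    _ = _ := by rw [hK]; ring

/-- **Bramble–Hilbert lemma**: a function in `W^{s,p}(U)` is approximated by a polynomial of degree
less than `s`, at the optimal rate in all the seminorms of order at most `s`. -/
theorem bramble_hilbert {B : Set (Space d)} (hU : IsOpen U)
    (hUb : Bornology.IsBounded U) (hBU : B ⊆ U) (hBm : MeasurableSet B) (hB0 : volume B ≠ 0)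
    (hstar : ∀ y ∈ B, StarConvex ℝ y U) (hp : 1 ≤ p) {A : ℝ≥0∞} (hA : 1 ≤ A)
    (hUB : volume U ≤ A * volume B) (hv : HasWeakDerivs U s p v) :
    ∃ Q : MvPolynomial (Fin d) ℝ, Q.totalDegree ≤ s - 1 ∧ ∀ r ≤ s,
      sobolevSeminorm U r p (v - polyFun d Q) ≤
        (ENNReal.ofReal (Metric.diam U) * (2 ^ (d + 1) * A * d)) ^ (s - r) *
          sobolevSeminorm U s p v := by
  have : IsFiniteMeasure (volume.restrict U) := ⟨by simpa using hUb.measure_lt_top⟩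
  obtain ⟨Q, hdeg, hzero, hint⟩ := exists_polynomial_integral_multiDeriv (hUb.subset hBU) hB0 s
    fun α => ∫ x in B, weakDeriv U α v x
  have hQ := contDiff_polyFun Q
  have hQw : HasWeakDerivs U s p (polyFun d Q) := hasWeakDerivs_of_contDiff hUb hQ s p
  have hderiv : ∀ α : Fin d → ℕ, ∑ i, α i ≤ s → weakDeriv U α (v - polyFun d Q)
      =ᵐ[volume.restrict U] weakDeriv U α v - multiDeriv α (polyFun d Q) := fun α hα =>
    (weakDeriv_sub_ae_eq hU hv hQw hα).trans
      ((Filter.EventuallyEq.rfl).sub (weakDeriv_ae_eq_multiDeriv hU hQ α))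
  have hmean : ∀ α : Fin d → ℕ, ∑ i, α i < s →
      ∫ x in B, weakDeriv U α (v - polyFun d Q) x = 0 := by
    intro α hα
    rw [integral_congr_ae (ae_restrict_of_ae_restrict_of_subset hBU (hderiv α hα.le))]
    simp only [Pi.sub_apply]
    have hvi : IntegrableOn (weakDeriv U α v) U := (hv.memLp hU hα.le).integrable hp
    rw [integral_sub (hvi.mono_set hBU)
      (integrableOn_of_contDiff (hQ.multiDeriv α) (hUb.subset hBU)), hint α hα, sub_self]
  have htop : sobolevSeminorm U s p (v - polyFun d Q) = sobolevSeminorm U s p v := by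
    refine Finset.sum_congr rfl fun α hα => ?_
    have hαs := mem_piAntidiag_univ.1 hα
    rw [eLpNorm_congr_ae (hderiv α hαs.le), hzero α hαs.ge, sub_zero]
  refine ⟨Q, hdeg, fun r hr => ?_⟩
  -- Descent from `r = s`: each application of Poincaré trades one order of differentiation for one
  -- factor of the diameter.
  induction hn : s - r generalizing r with
  | zero =>
    obtain rfl : r = s := by omega
    rw [htop]; simp
  | succ n ih =>
    refine (sobolevSeminorm_le_succ hU hUb hBU hBm hB0 hstar hp hA hUB
      ((hv.sub hQw).mono (by omega)) fun α hα => hmean α (by omega)).trans ?_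
    refine (mul_le_mul_right (ih (r + 1) (by omega) (by omega)) _).trans (le_of_eq ?_)
    rw [pow_succ]
    ring

end

/-! ### An inverse inequality for polynomials -/

/-- `T ∘ S⁻¹` is linear on the finite-dimensional range of `S`, hence bounded. -/
lemma exists_bound_of_injective {V E F : Type*} [AddCommGroup V] [Module ℝ V]
    [FiniteDimensional ℝ V] [NormedAddCommGroup E] [NormedSpace ℝ E] [NormedAddCommGroup F]
    [NormedSpace ℝ F] {S : V →ₗ[ℝ] E} (hS : Function.Injective S) (T : V →ₗ[ℝ] F) :
    ∃ C : ℝ, ∀ v, ‖T v‖ ≤ C * ‖S v‖ := by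
  set e := LinearEquiv.ofInjective S hS
  set L : LinearMap.range S →L[ℝ] F :=
    LinearMap.toContinuousLinearMap (T ∘ₗ (e.symm : LinearMap.range S →ₗ[ℝ] V)) with hL
  refine ⟨‖L‖, fun v => ?_⟩
  have h := L.le_opNorm (e v)
  have h1 : L (e v) = T v := by simp [hL]
  rw [h1] at h
  exact h

/-- The ball contains a product of intervals, and a polynomial vanishing on a product of infinite
sets is zero. -/
lemma eq_zero_of_polyFun_eqOn {d : ℕ} {P : MvPolynomial (Fin d) ℝ} {r : ℝ} (hr : 0 < r)
    (h : Set.EqOn (polyFun d P) 0 (Metric.ball 0 r)) : P = 0 := by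
  have hopen : IsOpen ((WithLp.toLp 2 : (Fin d → ℝ) → Space d) ⁻¹' Metric.ball 0 r) :=
    Metric.isOpen_ball.preimage (PiLp.continuous_toLp 2 _)
  obtain ⟨δ, hδ, hsub⟩ := Metric.isOpen_iff.1 hopen 0 (by simpa using hr)
  refine MvPolynomial.funext_set (fun _ => Metric.ball (0 : ℝ) δ) (fun _ => ?_) fun x hx => ?_
  · rw [Real.ball_eq_Ioo]
    exact Set.Ioo_infinite (by linarith)
  · have hx' : x ∈ Metric.ball (0 : Fin d → ℝ) δ := by
      rw [ball_pi _ hδ]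
      exact hx
    have := h (hsub hx')
    rw [polyFun_apply] at this
    simpa using this

/-- The class in `L^p(B)` of a polynomial function on a bounded set `B`. -/
noncomputable def polyToLp {d : ℕ} {B : Set (Space d)} (hB : Bornology.IsBounded B) (p : ℝ≥0∞) :
    MvPolynomial (Fin d) ℝ →ₗ[ℝ] Lp ℝ p (volume.restrict B) where
  toFun P := (memLp_of_contDiff hB (contDiff_polyFun P) p).toLp (polyFun d P)
  map_add' P Q := by
    rw [← MemLp.toLp_add]
    simp only [map_add]
  map_smul' c P := by
    rw [RingHom.id_apply, ← MemLp.toLp_const_smul]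
    simp only [map_smul]

lemma enorm_polyToLp {d : ℕ} {B : Set (Space d)} (hB : Bornology.IsBounded B) (p : ℝ≥0∞)
    (P : MvPolynomial (Fin d) ℝ) :
    ‖polyToLp hB p P‖ₑ = eLpNorm (polyFun d P) p (volume.restrict B) :=
  Lp.enorm_toLp (memLp_of_contDiff hB (contDiff_polyFun P) p)

/-- On polynomials of degree at most `l`, the `L^p` norm over the small ball is a genuine norm, so
it controls every linear map. This is the reference configuration of the inverse inequality. -/
lemma exists_eLpNorm_pderiv_le (d l : ℕ) {r : ℝ} (hr : 0 < r) {p : ℝ≥0∞} (hp : 1 ≤ p) :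
    ∃ C : ℝ, 0 < C ∧ ∀ P : MvPolynomial (Fin d) ℝ, P.totalDegree ≤ l → ∀ i,
      eLpNorm (polyFun d (MvPolynomial.pderiv i P)) p
          (volume.restrict (Metric.closedBall 0 1)) ≤
        ENNReal.ofReal C * eLpNorm (polyFun d P) p (volume.restrict (Metric.ball 0 r)) := by
  have : Fact (1 ≤ p) := ⟨hp⟩
  set V := MvPolynomial.restrictTotalDegree (Fin d) ℝ l
  set S : V →ₗ[ℝ] _ :=
    polyToLp (Metric.isBounded_ball (x := (0 : Space d)) (r := r)) p ∘ₗ V.subtype with hS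
  have hinj : Function.Injective S := by
    rw [← LinearMap.ker_eq_bot, LinearMap.ker_eq_bot']
    intro P hP
    have h0 : eLpNorm (polyFun d P) p (volume.restrict (Metric.ball 0 r)) = 0 := by
      rw [← enorm_polyToLp Metric.isBounded_ball]
      change ‖S P‖ₑ = 0
      rw [hP, enorm_zero]
    rw [eLpNorm_eq_zero_iff (contDiff_polyFun _).continuous.aestronglyMeasurable
      (zero_lt_one.trans_le hp).ne'] at h0
    exact Subtype.ext (eq_zero_of_polyFun_eqOn hr (Measure.eqOn_open_of_ae_eq h0
      Metric.isOpen_ball (contDiff_polyFun _).continuous.continuousOn continuousOn_const))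
  choose C hC using fun i : Fin d => exists_bound_of_injective hinj
    (polyToLp (Metric.isBounded_closedBall (x := (0 : Space d)) (r := 1)) p ∘ₗ
      (MvPolynomial.pderiv i).toLinearMap ∘ₗ V.subtype)
  refine ⟨∑ i, |C i| + 1, by positivity, fun P hP i => ?_⟩
  have hi := hC i ⟨P, (MvPolynomial.mem_restrictTotalDegree _ _ _).2 hP⟩
  rw [← enorm_polyToLp Metric.isBounded_ball, ← enorm_polyToLp Metric.isBounded_closedBall,
    ← ofReal_norm, ← ofReal_norm, ← ENNReal.ofReal_mul (by positivity)]
  refine ENNReal.ofReal_le_ofReal (hi.trans (mul_le_mul_of_nonneg_right ?_ (norm_nonneg _)))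
  have := Finset.single_le_sum (f := fun i => |C i|) (fun i _ => abs_nonneg _) (Finset.mem_univ i)
  have := le_abs_self (C i)
  linarith

lemma totalDegree_aeval_le {σ τ R : Type*} [Fintype σ] [CommSemiring R]
    {f : σ → MvPolynomial τ R} (hf : ∀ i, (f i).totalDegree ≤ 1) (P : MvPolynomial σ R) :
    (MvPolynomial.aeval f P).totalDegree ≤ P.totalDegree := by
  rw [MvPolynomial.aeval_def, MvPolynomial.eval₂_eq']
  refine MvPolynomial.totalDegree_finsetSum_le fun u hu => ?_
  refine (MvPolynomial.totalDegree_mul _ _).trans ?_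
  rw [MvPolynomial.algebraMap_eq, MvPolynomial.totalDegree_C, zero_add]
  refine (MvPolynomial.totalDegree_finsetProd _ _).trans ?_
  have hsum : ∑ i, u i ≤ P.totalDegree := by
    have := MvPolynomial.le_totalDegree hu
    rwa [Finsupp.sum_fintype _ _ (fun _ => rfl)] at this
  refine (Finset.sum_le_sum fun i _ => ?_).trans hsum
  refine (MvPolynomial.totalDegree_pow _ _).trans ?_
  simpa using Nat.mul_le_mul_left (u i) (hf i)

/-- The polynomial `y ↦ P (c + h y)`. -/
noncomputable def affineSubst {d : ℕ} (c : Space d) (h : ℝ) :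
    MvPolynomial (Fin d) ℝ →ₐ[ℝ] MvPolynomial (Fin d) ℝ :=
  MvPolynomial.aeval fun i => MvPolynomial.C (c i) + MvPolynomial.C h * MvPolynomial.X i

lemma polyFun_affineSubst {d : ℕ} (c : Space d) (h : ℝ) (P : MvPolynomial (Fin d) ℝ)
    (y : Space d) : polyFun d (affineSubst c h P) y = polyFun d P (c + h • y) := by
  induction P using MvPolynomial.induction_on with
  | C a => simp [polyFun_apply, affineSubst]
  | add P Q hP hQ => simp only [map_add, Pi.add_apply, hP, hQ]
  | mul_X P i hP =>
    rw [map_mul, polyFun_mul, polyFun_mul, Pi.mul_apply, Pi.mul_apply, hP]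
    simp [polyFun_apply, affineSubst]

lemma totalDegree_affineSubst_le {d : ℕ} (c : Space d) (h : ℝ) (P : MvPolynomial (Fin d) ℝ) :
    (affineSubst c h P).totalDegree ≤ P.totalDegree := by
  refine totalDegree_aeval_le (fun i => ?_) P
  refine (MvPolynomial.totalDegree_add _ _).trans (max_le (by simp) ?_)
  refine (MvPolynomial.totalDegree_mul _ _).trans ?_
  simp

lemma pderiv_affineSubst {d : ℕ} (c : Space d) (h : ℝ) (P : MvPolynomial (Fin d) ℝ) (i : Fin d) :
    MvPolynomial.pderiv i (affineSubst c h P) =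
      h • affineSubst c h (MvPolynomial.pderiv i P) := by
  induction P using MvPolynomial.induction_on with
  | C a => simp [affineSubst]
  | add P Q hP hQ => simp only [map_add, hP, hQ, smul_add]
  | mul_X P j hP =>
    have hX : affineSubst c h (MvPolynomial.X j) =
        MvPolynomial.C (c j) + MvPolynomial.C h * MvPolynomial.X j := by simp [affineSubst]
    simp only [map_mul, Derivation.leibniz, hP, map_add, smul_eq_mul, hX, MvPolynomial.pderiv_X,
      MvPolynomial.pderiv_C, MvPolynomial.smul_eq_C_mul]
    rcases eq_or_ne j i with rfl | hij
    · simp; ring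
    · simp [hij]; ring

lemma eLpNorm_comp_affine {d : ℕ} {U : Set (Space d)} (hU : MeasurableSet U) (c : Space d) {h : ℝ}
    (hh : h ≠ 0) (p : ℝ≥0∞) {f : Space d → ℝ} (hf : Continuous f) :
    eLpNorm (fun y => f (c + h • y)) p
        (volume.restrict ((fun y : Space d => c + h • y) ⁻¹' U)) =
      ENNReal.ofReal |(h ^ d)⁻¹| ^ (1 / p).toReal * eLpNorm f p (volume.restrict U) := by
  have hm : Measurable fun y : Space d => c + h • y := by fun_prop
  have hmap : Measure.map (fun y : Space d => c + h • y) volume =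
      ENNReal.ofReal |(h ^ d)⁻¹| • (volume : Measure (Space d)) := by
    have h1 := Measure.map_map (μ := (volume : Measure (Space d))) (measurable_const_add c)
      (measurable_const_smul h)
    change _ = Measure.map (fun y : Space d => c + h • y) volume at h1
    rw [← h1, Measure.map_addHaar_smul volume hh, finrank_euclideanSpace, Fintype.card_fin,
      Measure.map_smul, (measurePreserving_add_left volume c).map_eq]
  have h2 := eLpNorm_map_measure (p := p) (g := f)
    (μ := volume.restrict ((fun y : Space d => c + h • y) ⁻¹' U))
    (f := fun y : Space d => c + h • y) hf.aestronglyMeasurable hm.aemeasurable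
  change _ = eLpNorm (fun y => f (c + h • y)) p _ at h2
  rw [← h2, ← Measure.restrict_map hm hU, hmap, Measure.restrict_smul,
    eLpNorm_smul_measure_of_ne_zero, smul_eq_mul]
  exact (ENNReal.ofReal_pos.2 (abs_pos.2 (inv_ne_zero (pow_ne_zero _ hh)))).ne'

/-- Inverse inequality for the first derivatives of a polynomial. -/
lemma exists_inverse_inequality_partialDeriv (d l : ℕ) {r : ℝ} (hr : 0 < r) {p : ℝ≥0∞}
    (hp : 1 ≤ p) :
    ∃ C : ℝ, 0 < C ∧ ∀ (U : Set (Space d)) (c : Space d) (h : ℝ), MeasurableSet U → 0 < h →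
      Metric.ball c (r * h) ⊆ U → U ⊆ Metric.closedBall c h →
      ∀ P : MvPolynomial (Fin d) ℝ, P.totalDegree ≤ l → ∀ i,
        ENNReal.ofReal h * eLpNorm (partialDeriv i (polyFun d P)) p (volume.restrict U) ≤
          ENNReal.ofReal C * eLpNorm (polyFun d P) p (volume.restrict U) := by
  obtain ⟨C, hC0, hC⟩ := exists_eLpNorm_pderiv_le d l hr hp
  refine ⟨C, hC0, fun U c h hU hh hball hcball P hP i => ?_⟩
  have key := hC (affineSubst c h P) ((totalDegree_affineSubst_le c h P).trans hP) i
  set κ := ENNReal.ofReal |(h ^ d)⁻¹| ^ (1 / p).toReal with hκ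
  have hpos : (0 : ℝ) < |(h ^ d)⁻¹| := abs_pos.2 (inv_ne_zero (pow_ne_zero _ hh.ne'))
  have hκ0 : κ ≠ 0 := (ENNReal.rpow_pos (ENNReal.ofReal_pos.2 hpos) ENNReal.ofReal_ne_top).ne'
  have hκt : κ ≠ ⊤ := ENNReal.rpow_ne_top_of_nonneg ENNReal.toReal_nonneg ENNReal.ofReal_ne_top
  have hsub1 : (fun y : Space d => c + h • y) ⁻¹' U ⊆ Metric.closedBall 0 1 := by
    intro y hy
    have := hcball hy
    rw [Metric.mem_closedBall, dist_eq_norm, add_sub_cancel_left, norm_smul, Real.norm_of_nonneg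
      hh.le] at this
    rw [mem_closedBall_zero_iff]
    exact le_of_mul_le_mul_left (by simpa using this) hh
  have hsub2 : Metric.ball 0 r ⊆ (fun y : Space d => c + h • y) ⁻¹' U := by
    intro y hy
    apply hball
    rw [mem_ball_zero_iff] at hy
    rw [Metric.mem_ball, dist_eq_norm, add_sub_cancel_left, norm_smul, Real.norm_of_nonneg hh.le,
      mul_comm]
    gcongr
  have h1 := (eLpNorm_mono_measure (p := p)
    (polyFun d (MvPolynomial.pderiv i (affineSubst c h P)))
    (Measure.restrict_mono_set volume hsub1)).trans key
  have h2 := h1.trans (mul_le_mul_right (eLpNorm_mono_measure (p := p)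
    (polyFun d (affineSubst c h P)) (Measure.restrict_mono_set volume hsub2)) _)
  -- Both norms acquire the same scaling factor `κ`, which is nonzero and finite and cancels. The
  -- factor `h` left over is that of the chain rule.
  rw [pderiv_affineSubst, map_smul, eLpNorm_const_smul, Real.enorm_of_nonneg hh.le,
    funext (polyFun_affineSubst c h P), funext (polyFun_affineSubst c h (MvPolynomial.pderiv i P)),
    eLpNorm_comp_affine hU c hh.ne' p (contDiff_polyFun _).continuous,
    eLpNorm_comp_affine hU c hh.ne' p (contDiff_polyFun _).continuous, ← hκ, mul_left_comm,
    mul_left_comm _ κ, ENNReal.mul_le_mul_iff_right hκ0 hκt] at h2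
  rwa [partialDeriv_polyFun]

/-- Every index of nonzero order arises from at least one pair `(α, i)`; repetitions only enlarge
the right side. -/
lemma sum_piAntidiag_succ_le {d : ℕ} (f : (Fin d → ℕ) → ℝ≥0∞) (r : ℕ) :
    ∑ β ∈ Finset.piAntidiag (Finset.univ : Finset (Fin d)) (r + 1), f β ≤
      ∑ α ∈ Finset.piAntidiag (Finset.univ : Finset (Fin d)) r, ∑ i, f (α + Pi.single i 1) := by
  rw [← Finset.sum_product']
  refine (Finset.sum_le_sum_of_subset (t := ((Finset.piAntidiag Finset.univ r) ×ˢ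
    Finset.univ).image fun z : (Fin d → ℕ) × Fin d => z.1 + Pi.single z.2 1)
    fun β hβ => ?_).trans (Finset.sum_image_le_of_nonneg fun _ _ => zero_le)
  rw [mem_piAntidiag_univ] at hβ
  obtain ⟨i, -, hi⟩ := Finset.exists_ne_zero_of_sum_ne_zero (hβ.trans_ne (Nat.succ_ne_zero r))
  obtain ⟨α, rfl⟩ := exists_eq_add_single hi
  rw [sum_add_single] at hβ
  refine Finset.mem_image.2 ⟨(α, i), ?_, rfl⟩
  rw [Finset.mem_product, mem_piAntidiag_univ]
  exact ⟨Nat.succ.inj hβ, Finset.mem_univ i⟩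

/-- **Inverse inequality** for polynomials of degree at most `l`, with a constant that only depends
on the ratio of the radii of two concentric balls, one inside `U` and one around `U`. -/
theorem exists_inverse_inequality (d l : ℕ) {r : ℝ} (hr : 0 < r) {p : ℝ≥0∞} (hp : 1 ≤ p) :
    ∃ C : ℝ, 0 < C ∧ ∀ (U : Set (Space d)) (c : Space d) (h : ℝ), IsOpen U → 0 < h →
      Metric.ball c (r * h) ⊆ U → U ⊆ Metric.closedBall c h →
      ∀ P : MvPolynomial (Fin d) ℝ, P.totalDegree ≤ l → ∀ q k : ℕ,
        ENNReal.ofReal h ^ k * sobolevSeminorm U (q + k) p (polyFun d P) ≤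
          ENNReal.ofReal C ^ k * sobolevSeminorm U q p (polyFun d P) := by
  obtain ⟨C, hC0, hC⟩ := exists_inverse_inequality_partialDeriv d l hr hp
  -- A sum over `d` directions; `d + 1` keeps the constant positive for `d = 0`.
  refine ⟨(d + 1) * C, by positivity, fun U c h hU hh hball hcball P hP q k => ?_⟩
  have hP' := contDiff_polyFun P
  have hstep : ∀ m, ENNReal.ofReal h * sobolevSeminorm U (m + 1) p (polyFun d P) ≤
      ENNReal.ofReal ((d + 1) * C) * sobolevSeminorm U m p (polyFun d P) := by
    intro m
    simp only [sobolevSeminorm_of_contDiff hU hP']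
    refine (mul_le_mul_right (sum_piAntidiag_succ_le _ m) _).trans ?_
    rw [Finset.mul_sum, Finset.mul_sum]
    refine Finset.sum_le_sum fun α _ => ?_
    obtain ⟨R, hR, hdeg⟩ := exists_multiDeriv_polyFun_eq P α
    rw [Finset.mul_sum]
    refine (Finset.sum_le_card_nsmul _ _ (ENNReal.ofReal C *
      eLpNorm (multiDeriv α (polyFun d P)) p (volume.restrict U)) fun i _ => ?_).trans ?_
    · rw [multiDeriv_add_single hP', hR]
      exact hC U c h hU.measurableSet hh hball hcball R (by omega) i
    · rw [Finset.card_univ, Fintype.card_fin, nsmul_eq_mul, ← mul_assoc]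
      gcongr
      rw [ENNReal.ofReal_mul (by positivity)]
      gcongr
      rw [← Nat.cast_add_one, ENNReal.ofReal_natCast]
      exact_mod_cast Nat.le_succ d
  induction k with
  | zero => simp
  | succ k ih =>
    calc ENNReal.ofReal h ^ (k + 1) * sobolevSeminorm U (q + (k + 1)) p (polyFun d P)
        = ENNReal.ofReal h ^ k *
          (ENNReal.ofReal h * sobolevSeminorm U (q + k + 1) p (polyFun d P)) := by
          rw [pow_succ, mul_assoc]; rfl
      _ ≤ ENNReal.ofReal h ^ k *
          (ENNReal.ofReal ((d + 1) * C) * sobolevSeminorm U (q + k) p (polyFun d P)) := by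
          exact mul_le_mul' le_rfl (hstep _)
      _ = ENNReal.ofReal ((d + 1) * C) *
          (ENNReal.ofReal h ^ k * sobolevSeminorm U (q + k) p (polyFun d P)) := by ring
      _ ≤ ENNReal.ofReal ((d + 1) * C) *
          (ENNReal.ofReal ((d + 1) * C) ^ k * sobolevSeminorm U q p (polyFun d P)) := by gcongr
      _ = _ := by rw [pow_succ]; ring

/-! ### Approximation by a polynomial projector -/

/-- In dimension zero the whole space is a point, which is why `1 ≤ d` is needed. -/
lemma diam_pos_of_isOpen {d : ℕ} (hd : 1 ≤ d) {U : Set (Space d)} (hU : IsOpen U)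
    (hUb : Bornology.IsBounded U) (hne : U.Nonempty) : 0 < Metric.diam U := by
  have : Nonempty (Fin d) := ⟨⟨0, hd⟩⟩
  obtain ⟨x, hx⟩ := hne
  have := Module.punctured_nhds_neBot ℝ (Space d) x
  exact Metric.diam_pos (infinite_of_mem_nhds x (hU.mem_nhds hx)).nontrivial hUb

lemma volume_le_of_subset_closedBall {d : ℕ} {U : Set (Space d)} {c : Space d} {ρ h : ℝ}
    (hρ : 0 < ρ) (hh : 0 < h) (hU : U ⊆ Metric.closedBall c h) :
    volume U ≤ ENNReal.ofReal ((ρ ^ d)⁻¹) * volume (Metric.ball c (ρ * h)) := by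
  refine (measure_mono hU).trans (le_of_eq ?_)
  rw [Measure.addHaar_closedBall _ _ hh.le, Measure.addHaar_ball_of_pos _ c (r := ρ * h) (by positivity),
    ← mul_assoc, ← ENNReal.ofReal_mul (by positivity), finrank_euclideanSpace, Fintype.card_fin]
  congr 2
  rw [mul_pow]
  field_simp

lemma mk_polyFun_mem_sobolev {d : ℕ} {U : Set (Space d)} (hUb : Bornology.IsBounded U) (s : ℕ)
    (p : ℝ≥0∞) (Q : MvPolynomial (Fin d) ℝ) :
    (AEEqFun.mk (polyFun d Q) (contDiff_polyFun Q).continuous.aestronglyMeasurable : AEFun U) ∈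
      Sobolev U s p := by
  have hQ := contDiff_polyFun Q
  have hae : (AEEqFun.mk (polyFun d Q) hQ.continuous.aestronglyMeasurable : AEFun U)
      =ᵐ[volume.restrict U] polyFun d Q := AEEqFun.coeFn_mk _ _
  exact ⟨(memLp_of_contDiff hUb hQ p).ae_eq hae.symm,
    (hasWeakDerivs_of_contDiff hUb hQ s p).congr hae.symm⟩

/-- Subtracting a polynomial of degree at most `l` changes neither `v - Pr v` nor its seminorms. -/
lemma exists_sub_projector_eq {d : ℕ} {U : Set (Space d)} (hUb : Bornology.IsBounded U)
    {p : ℝ≥0∞} (hp : 1 ≤ p) {l s q : ℕ} (hq : q ≤ s)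
    {Pr : Sobolev U q 1 →ₗ[ℝ] polySpace U l} (hPr : IsPolyProjector Pr) (v : Sobolev U s p)
    {Q : MvPolynomial (Fin d) ℝ} (hQ : Q.totalDegree ≤ l) :
    ∃ (u : Sobolev U q p) (P : MvPolynomial (Fin d) ℝ), P.totalDegree ≤ l ∧
      ((u : AEFun U) : Space d → ℝ) =ᵐ[volume.restrict U] (v : AEFun U) - polyFun d Q ∧
      ((Pr (Submodule.inclusion (Sobolev.le_of_isBounded hUb le_rfl hp) u) : AEFun U) :
        Space d → ℝ) =ᵐ[volume.restrict U] polyFun d P ∧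
      (((v : AEFun U) - (Pr (Submodule.inclusion (Sobolev.le_of_isBounded hUb hq hp) v) : AEFun U) :
        AEFun U) : Space d → ℝ) =ᵐ[volume.restrict U]
          ((v : AEFun U) - polyFun d Q) - polyFun d P := by
  set Qe : AEFun U := AEEqFun.mk (polyFun d Q)
    (contDiff_polyFun Q).continuous.aestronglyMeasurable with hQe
  have hQae : Qe =ᵐ[volume.restrict U] polyFun d Q := AEEqFun.coeFn_mk _ _
  set Qq : Sobolev U q p := ⟨Qe, mk_polyFun_mem_sobolev hUb q p Q⟩ with hQq
  set u : Sobolev U q p :=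
    Submodule.inclusion (Sobolev.le_of_isBounded hUb hq le_rfl) v - Qq with hu
  obtain ⟨P, hPdeg, hPae⟩ :=
    (Pr (Submodule.inclusion (Sobolev.le_of_isBounded hUb le_rfl hp) u)).2
  have hfix : (Pr (Submodule.inclusion (Sobolev.le_of_isBounded hUb le_rfl hp) Qq) : AEFun U) =
      Qe := hPr _ ⟨Q, hQ, hQae⟩
  have hPru : (Pr (Submodule.inclusion (Sobolev.le_of_isBounded hUb le_rfl hp) u) : AEFun U) =
      (Pr (Submodule.inclusion (Sobolev.le_of_isBounded hUb hq hp) v) : AEFun U) - Qe := by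
    rw [hu, map_sub, map_sub, Submodule.coe_sub, hfix]
    rfl
  have huae : ((u : AEFun U) : Space d → ℝ) =ᵐ[volume.restrict U]
      (v : AEFun U) - polyFun d Q := by
    have h1 := AEEqFun.coeFn_sub (v : AEFun U) Qe
    have h2 : (u : AEFun U) = (v : AEFun U) - Qe := rfl
    rw [h2]
    filter_upwards [h1, hQae] with x hx hx'
    rw [hx, Pi.sub_apply, Pi.sub_apply, hx']
  refine ⟨u, P, hPdeg, huae, hPae, ?_⟩
  have h3 : (v : AEFun U) - (Pr (Submodule.inclusion (Sobolev.le_of_isBounded hUb hq hp) v) :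
      AEFun U) = (u : AEFun U) -
      (Pr (Submodule.inclusion (Sobolev.le_of_isBounded hUb le_rfl hp) u) : AEFun U) := by
    rw [hPru]
    have h2 : (u : AEFun U) = (v : AEFun U) - Qe := rfl
    rw [h2]
    abel
  rw [h3]
  exact (AEEqFun.coeFn_sub _ _).trans (huae.sub hPae)

/-- The Bramble–Hilbert lemma on domains that are star-shaped with respect to a ball whose radius is
a given fraction of the diameter. -/
lemma exists_bramble_hilbert_starShaped (d : ℕ) (hd : 1 ≤ d) {ρ : ℝ} (hρ : 0 < ρ) {p : ℝ≥0∞}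
    (hp : 1 ≤ p) (s : ℕ) :
    ∃ K : ℝ, 0 < K ∧ ∀ (U : Set (Space d)) (c : Space d), IsOpen U → Bornology.IsBounded U →
      0 < Metric.diam U → Metric.ball c (ρ * Metric.diam U) ⊆ U →
      (∀ x ∈ Metric.ball c (ρ * Metric.diam U), StarConvex ℝ x U) →
      ∀ v : Space d → ℝ, HasWeakDerivs U s p v →
      ∃ Q : MvPolynomial (Fin d) ℝ, Q.totalDegree ≤ s - 1 ∧ ∀ r ≤ s,
        sobolevSeminorm U r p (v - polyFun d Q) ≤
          ENNReal.ofReal (K * Metric.diam U ^ (s - r)) * sobolevSeminorm U s p v := by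
  -- `ρ^(-d)` is the volume ratio of the balls of radii `h` and `ρ h`, `h` being the diameter; the
  -- maximum secures `1 ≤ A`.
  set A : ℝ := max 1 (ρ ^ d)⁻¹ with hA
  have hA1 : 1 ≤ A := le_max_left _ _
  set M : ℝ := 2 ^ (d + 1) * A * d with hM
  have hd' : (1 : ℝ) ≤ d := by exact_mod_cast hd
  -- Allows `M ^ (s - r)` to be replaced by `M ^ s`, a constant independent of `r`.
  have hM1 : 1 ≤ M := by
    have : (1 : ℝ) ≤ 2 ^ (d + 1) := one_le_pow₀ (by norm_num)
    exact one_le_mul_of_one_le_of_one_le (one_le_mul_of_one_le_of_one_le this hA1) hd'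
  refine ⟨M ^ s, by positivity, fun U c hU hUb hh hball hstar v hv => ?_⟩
  have hcB : c ∈ Metric.ball c (ρ * Metric.diam U) := Metric.mem_ball_self (by positivity)
  have hUc : U ⊆ Metric.closedBall c (Metric.diam U) := fun x hx =>
    Metric.mem_closedBall.2 (Metric.dist_le_diam_of_mem hUb hx (hball hcB))
  have hvol : volume U ≤ ENNReal.ofReal A * volume (Metric.ball c (ρ * Metric.diam U)) := by
    refine (volume_le_of_subset_closedBall hρ hh hUc).trans ?_
    gcongr
    exact le_max_right _ _
  obtain ⟨Q, hdeg, hQ⟩ := bramble_hilbert hU hUb hball Metric.isOpen_ball.measurableSet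
    (Metric.measure_ball_pos volume c (by positivity)).ne' hstar hp
    (by simpa using ENNReal.ofReal_le_ofReal hA1) hvol hv
  refine ⟨Q, hdeg, fun r hr => (hQ r hr).trans ?_⟩
  gcongr
  have hMe : (2 ^ (d + 1) * ENNReal.ofReal A * d : ℝ≥0∞) = ENNReal.ofReal M := by
    rw [hM, ENNReal.ofReal_mul (by positivity), ENNReal.ofReal_mul (by positivity),
      ENNReal.ofReal_natCast, ENNReal.ofReal_pow (by norm_num)]
    simp
  rw [hMe, ← ENNReal.ofReal_mul hh.le, ← ENNReal.ofReal_pow (by positivity), mul_pow, mul_comm]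
  gcongr
  exact Nat.sub_le s r

theorem lemma1 (d : ℕ) (hd : 1 ≤ d) (ρ : ℝ) (hρ : 0 < ρ) (p : ℝ≥0∞) (hp : 1 ≤ p)
    (l s q m : ℕ) (hs : 1 ≤ s) (hsl : s ≤ l + 1) (hq : q ≤ s) (hm : m ≤ s)
    (C₀ : ℝ) (hC₀ : 0 < C₀) :
    ∃ C : ℝ, 0 < C ∧
      ∀ (U : Set (Space d)) (_ : IsOpen U) (hUb : Bornology.IsBounded U) (_ : IsConnected U)
        (_ : ∃ c : Space d, Metric.ball c (ρ * Metric.diam U) ⊆ U ∧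
          ∀ x ∈ Metric.ball c (ρ * Metric.diam U), StarConvex ℝ x U)
        (Pr : Sobolev U q 1 →ₗ[ℝ] polySpace U l) (_ : IsPolyProjector Pr)
        (_ : m < q → ∀ v : Sobolev U q p,
          sobolevSeminorm U m p
              (Pr (Submodule.inclusion (Sobolev.le_of_isBounded hUb le_rfl hp) v) : AEFun U) ≤
            ENNReal.ofReal C₀ * ∑ r ∈ Finset.Icc m q,
              ENNReal.ofReal (Metric.diam U ^ (r - m)) * sobolevSeminorm U r p (v : AEFun U))
        (_ : q ≤ m → ∀ v : Sobolev U q p,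
          sobolevSeminorm U q p
              (Pr (Submodule.inclusion (Sobolev.le_of_isBounded hUb le_rfl hp) v) : AEFun U) ≤
            ENNReal.ofReal C₀ * sobolevSeminorm U q p (v : AEFun U)),
        ∀ v : Sobolev U s p,
          sobolevSeminorm U m p
              ((v : AEFun U) -
                (Pr (Submodule.inclusion (Sobolev.le_of_isBounded hUb hq hp) v) : AEFun U) :
                  AEFun U) ≤
            ENNReal.ofReal (C * Metric.diam U ^ (s - m)) *
              sobolevSeminorm U s p (v : AEFun U) := by
  obtain ⟨K, hK0, hBH⟩ := exists_bramble_hilbert_starShaped d hd hρ hp s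
  obtain ⟨L, hL0, hinv⟩ := exists_inverse_inequality d l hρ hp
  -- One term for `v - Q`, one for the case `m < q`, where the stability sum has at most `q + 1`
  -- terms, and one for `m ≥ q`. Adding all three gives one constant for both cases.
  refine ⟨K + (C₀ * ((q + 1) * K) + L ^ (m - q) * (C₀ * K)), by positivity, ?_⟩
  rintro U hU hUb hconn ⟨c, hball, hstar⟩ Pr hPr hlow hhigh v
  set h := Metric.diam U with hh_def
  have hh : 0 < h := diam_pos_of_isOpen hd hU hUb hconn.nonempty
  have hcB : c ∈ Metric.ball c (ρ * h) := Metric.mem_ball_self (by positivity)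
  have hUc : U ⊆ Metric.closedBall c h := fun x hx =>
    Metric.mem_closedBall.2 (Metric.dist_le_diam_of_mem hUb hx (hball hcB))
  have hv : HasWeakDerivs U s p (v : AEFun U) := v.2.2
  obtain ⟨Q, hQdeg, hQ⟩ := hBH U c hU hUb hh hball hstar _ hv
  obtain ⟨u, P, hPdeg, hu, hPu, hsub⟩ :=
    exists_sub_projector_eq hUb hp hq hPr v (hQdeg.trans (by omega : s - 1 ≤ l))
  set S := sobolevSeminorm U s p (v : AEFun U) with hS
  have hsplit := sobolevSeminorm_sub_le hU hp
    ((hv.sub (hasWeakDerivs_of_contDiff hUb (contDiff_polyFun Q) s p)).mono hm)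
    (hasWeakDerivs_of_contDiff hUb (contDiff_polyFun P) m p)
  rw [sobolevSeminorm_congr hsub]
  have hfin : sobolevSeminorm U m p (polyFun d P) ≤
      ENNReal.ofReal ((C₀ * ((q + 1) * K) + L ^ (m - q) * (C₀ * K)) * h ^ (s - m)) * S := by
    rcases lt_or_ge m q with hmq | hqm
    · have h1 := hlow hmq u
      rw [sobolevSeminorm_congr hPu] at h1
      calc sobolevSeminorm U m p (polyFun d P)
          ≤ ENNReal.ofReal C₀ * ∑ r ∈ Finset.Icc m q, ENNReal.ofReal (h ^ (r - m)) *
              sobolevSeminorm U r p (u : AEFun U) := h1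
        _ ≤ ENNReal.ofReal C₀ * ∑ r ∈ Finset.Icc m q, ENNReal.ofReal (K * h ^ (s - m)) * S := by
            refine mul_le_mul' le_rfl (Finset.sum_le_sum fun r hr => ?_)
            rw [Finset.mem_Icc] at hr
            rw [sobolevSeminorm_congr hu]
            refine (mul_le_mul' le_rfl (hQ r (hr.2.trans hq))).trans (le_of_eq ?_)
            rw [← mul_assoc, ← ENNReal.ofReal_mul (by positivity), mul_left_comm, ← pow_add]
            congr 4
            omega
        _ ≤ ENNReal.ofReal C₀ * ((q + 1 : ℕ) * (ENNReal.ofReal (K * h ^ (s - m)) * S)) := by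
            rw [Finset.sum_const, nsmul_eq_mul]
            gcongr
            simp
        _ = ENNReal.ofReal (C₀ * ((q + 1) * K) * h ^ (s - m)) * S := by
            rw [← ENNReal.ofReal_natCast, ← mul_assoc, ← mul_assoc,
              ← ENNReal.ofReal_mul hC₀.le, ← ENNReal.ofReal_mul (by positivity)]
            congr 2
            push_cast
            ring
        _ ≤ _ := by
            gcongr
            exact le_add_of_nonneg_right (by positivity)
    · have h1 := hhigh hqm u
      rw [sobolevSeminorm_congr hPu, sobolevSeminorm_congr hu] at h1
      have h2 := hinv U c h hU hh hball hUc P hPdeg q (m - q)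
      rw [Nat.add_sub_cancel' hqm] at h2
      have hpow : ENNReal.ofReal h ^ (m - q) = ENNReal.ofReal (h ^ (m - q)) :=
        (ENNReal.ofReal_pow hh.le _).symm
      have h0 : ENNReal.ofReal (h ^ (m - q)) ≠ 0 := (ENNReal.ofReal_pos.2 (by positivity)).ne'
      -- The inverse inequality carries `h ^ (m - q)` on its left side, so the goal is multiplied by
      -- this factor instead of dividing.
      rw [← ENNReal.mul_le_mul_iff_right h0 ENNReal.ofReal_ne_top, ← hpow]
      calc ENNReal.ofReal h ^ (m - q) * sobolevSeminorm U m p (polyFun d P)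
          ≤ ENNReal.ofReal L ^ (m - q) * sobolevSeminorm U q p (polyFun d P) := h2
        _ ≤ ENNReal.ofReal L ^ (m - q) *
              (ENNReal.ofReal C₀ * (ENNReal.ofReal (K * h ^ (s - q)) * S)) := by
            refine mul_le_mul' le_rfl (h1.trans (mul_le_mul' le_rfl (hQ q hq)))
        _ = ENNReal.ofReal h ^ (m - q) *
              (ENNReal.ofReal (L ^ (m - q) * (C₀ * K) * h ^ (s - m)) * S) := by
            have hsq : s - q = (m - q) + (s - m) := by omega
            rw [hpow, ← ENNReal.ofReal_pow hL0.le, ← mul_assoc, ← mul_assoc, ← mul_assoc,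
              ← ENNReal.ofReal_mul (by positivity), ← ENNReal.ofReal_mul (by positivity),
              ← ENNReal.ofReal_mul (by positivity), hsq, pow_add]
            congr 2
            ring
        _ ≤ _ := by
            gcongr
            exact le_add_of_nonneg_left (by positivity)
  refine hsplit.trans ((add_le_add (hQ m hm) hfin).trans (le_of_eq ?_))
  rw [← add_mul, ← ENNReal.ofReal_add (by positivity) (by positivity), ← add_mul]
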